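/- **Setting.** Let $\mathcal X=\{1,2,3,\dots\}$ and let $\mathcal P(\mathcal X)$ be the set of probability distributions on $\mathcal X$. For $P\in\mathcal P(\mathcal X)$ let $P^{\downarrow}$ be its decreasing rearrangement ($P^{\downarrow}(k)$ is the $k$-th largest mass of $P$, counted with multiplicity). Let $\phi:\mathcal P(\mathcal X)\to[0,\infty]$ be symmetric ($\phi(P)=\phi(P^{\downarrow})$ for all $P$), concave, and lower semicontinuous with respect to pointwise convergence. For random variables $X\in\mathcal X$ and $Y\in\mathcal Y$ on a common probability space put $\mathfrak h_\phi(X\mid Y)=\mathbb E[\phi(P_{X|Y})]$, where $P_{X|Y}$ is the conditional distribution of $X$ given $Y$, and $$P_{\mathrm e}^{(L)}(X\mid Y)=\min_f\mathbb P\{X\notin f(Y)\},$$ the minimum being over all maps $f$ from $\mathcal Y$ to the nonempty subsets of $\mathcal X$ with at most $L$ elements. For $Q\in\mathcal P(\mathcal X)$ put $P_{\mathrm e}^{(L)}(Q)=1-\sum_{x=1}^{L}Q^{\downarrow}(x)$. Let $\mathcal Y$ be a finite set with its discrete $\sigma$-algebra, $L\ge1$ an integer, $Q\in\mathcal P(\mathcal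 X)$, and let $\varepsilon$ satisfy $$1-\sum_{x=1}^{|\mathcal Y|L}Q^{\downarrow}(x)\le\varepsilon\le P_{\mathrm e}^{(L)}(Q).$$ Define $V(j)=\frac{(1-\varepsilon)-\sum_{x=1}^{j-1}Q^{\downarrow}(x)}{L-j+1}$ for $1\le j\le L$ and $V(j)=1$ for $j>L$; $W(L)=-1$, $W(k)=\frac{\sum_{x=1}^{k}Q^{\downarrow}(x)-(1-\varepsilon)}{k-L}$ for $L<k<\infty$, and $W(\infty)=0$; $$J=\min\{j\ge1: Q^{\downarrow}(j)<V(j)\},\qquad K_1=\sup\{L\le k<\infty: W(k)<Q^{\downarrow}(k)\},$$ $$K_2=\max\{L\le k\le|\mathcal Y|L: W(k)<Q^{\downarrow}(k)\}.$$ For $i=1,2$ let $P_i$ (the Fano distribution of type $i$) be the distribution on $\mathcal X$ with $P_i(x)=Q^{\downarrow}(x)$ if $x<J$ or $x>K_i$, $P_i(x)=V(J)$ if $J\le x\le L$, and $P_i(x)=W(K_i)$ if $L<x\le K_i$. **Theorem.** Let $$S=\sup\{\mathfrak h_\phi(X\mid Y): P_{\mathrm e}^{(L)}(X\mid Y)\le\varepsilon,\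 P_X=Q\},$$ the supremum being over all $\mathcal X\times\mathcal Y$-valued random variables $(X,Y)$. Then: 1. $S\le\phi(P_2)\le\phi(P_1)$. 2. $S=\phi(P_2)$ if $\varepsilon=P_{\mathrm e}^{(L)}(Q)$, or if $|\mathcal Y|\ge\min\left\{\binom{K_2-J+1}{L-J+1},(K_2-J)^2+1\right\}$. 3. If $P_X=Q$ and $$P_{X|Y}^{\downarrow}(x)=P_2^{\downarrow}(x)\quad\text{almost surely, for every }x\in\mathcal X,\tag{$*$}$$ then $P_{\mathrm e}^{(L)}(X\mid Y)\le\varepsilon$ and $\mathfrak h_\phi(X\mid Y)=S=\phi(P_2)$. 4. Suppose that the concavity of $\phi$ is strict (i.e. $\lambda\phi(P)+(1-\lambda)\phi(R)<\phi(\lambda P+(1-\lambda)R)$ whenever $P\ne R$, $0<\lambda<1$ and $\phi(P),\phi(R)<\infty$), that $\phi(P_2)<\infty$, and that $S=\phi(P_2)$. Then a pair $(X,Y)$ with $P_X=Q$ satisfies $P_{\mathrm e}^{(L)}(X\mid Y)\le\varepsilon$ and $\mathfrak h_\phi(X\mid Y)=S$ if and only if $(*)$ holds. -/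

import Mathlib

open MeasureTheory ProbabilityTheory Filter Topology
open scoped ENNReal

/-- A probability distribution on the countably infinite alphabet `{1, 2, 3, …}`. The symbol
written `x` on paper is represented by the natural number `x - 1`, so `P.mass i = P(i + 1)`. -/
@[ext]
structure Marginal where
  mass : ℕ → ℝ
  nonneg : ∀ x, 0 ≤ mass x
  hasSum : HasSum mass 1

namespace Marginal

theorem mass_le_one (P : Marginal) (x : ℕ) : P.mass x ≤ 1 :=
  le_hasSum P.hasSum x fun y _ => P.nonneg y

/-- The `(i + 1)`-st largest mass of `P` (counted with multiplicity), i.e. `P↓(i + 1)`: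
the largest `t` such that at least `i + 1` symbols have mass at least `t`. -/
noncomputable def decMass (P : Marginal) (i : ℕ) : ℝ :=
  sSup {t : ℝ | ((i + 1 : ℕ) : ℕ∞) ≤ {x | t ≤ P.mass x}.encard}

theorem bddAbove_decMass (P : Marginal) (i : ℕ) :
    BddAbove {t : ℝ | ((i + 1 : ℕ) : ℕ∞) ≤ {x | t ≤ P.mass x}.encard} := by
  refine ⟨1, fun t ht => ?_⟩
  have hne : {x | t ≤ P.mass x}.Nonempty := by
    rw [← Set.encard_pos]
    exact lt_of_lt_of_le (by exact_mod_cast Nat.succ_pos i) ht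
  obtain ⟨x, hx⟩ := hne
  exact le_trans hx (P.mass_le_one x)

theorem zero_mem_decMass (P : Marginal) (i : ℕ) :
    (0 : ℝ) ∈ {t : ℝ | ((i + 1 : ℕ) : ℕ∞) ≤ {x | t ≤ P.mass x}.encard} := by
  have : {x | 0 ≤ P.mass x} = Set.univ := Set.eq_univ_of_forall P.nonneg
  simp [this]

theorem decMass_nonneg (P : Marginal) (i : ℕ) : 0 ≤ P.decMass i :=
  le_csSup (P.bddAbove_decMass i) (P.zero_mem_decMass i)

theorem decMass_antitone (P : Marginal) : Antitone P.decMass := by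
  intro i j hij
  refine csSup_le_csSup (P.bddAbove_decMass i) ⟨0, P.zero_mem_decMass j⟩ fun t ht => ?_
  have h : ((i + 1 : ℕ) : ℕ∞) ≤ ((j + 1 : ℕ) : ℕ∞) := Nat.cast_le.2 (Nat.succ_le_succ hij)
  exact h.trans ht

theorem lt_decMass_iff (P : Marginal) (t : ℝ) (i : ℕ) :
    t < P.decMass i ↔ ((i + 1 : ℕ) : ℕ∞) ≤ {x | t < P.mass x}.encard := by
  constructor
  · intro h
    obtain ⟨s, hs, hts⟩ := exists_lt_of_lt_csSup ⟨0, P.zero_mem_decMass i⟩ h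
    exact le_trans hs (Set.encard_le_encard fun x hx => lt_of_lt_of_le hts hx)
  · intro h
    obtain ⟨s, hsub, hcard⟩ := Set.exists_subset_encard_eq h
    have hfin : s.Finite := Set.finite_of_encard_eq_coe hcard
    have hne : s.Nonempty := by
      rw [← Set.encard_pos, hcard]
      exact_mod_cast Nat.succ_pos i
    obtain ⟨x, hx, hmin⟩ := hfin.exists_minimalFor P.mass s hne
    have hmin' : ∀ y ∈ s, P.mass x ≤ P.mass y := fun y hy =>
      (le_total (P.mass x) (P.mass y)).elim id fun h' => hmin hy h'
    refine lt_of_lt_of_le (hsub hx) (le_csSup (P.bddAbove_decMass i) ?_)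
    change ((i + 1 : ℕ) : ℕ∞) ≤ _
    rw [← hcard]
    exact Set.encard_le_encard hmin'

theorem encard_setOf_succ_le (n : ℕ∞) : {i : ℕ | ((i + 1 : ℕ) : ℕ∞) ≤ n}.encard = n := by
  induction n using ENat.recTopCoe with
  | top => simp
  | coe n =>
    have : {i : ℕ | ((i + 1 : ℕ) : ℕ∞) ≤ (n : ℕ∞)} = ↑(Finset.range n) := by
      ext i
      simp only [Set.mem_ofPred_eq, Finset.coe_range, Set.mem_Iio]
      rw [Nat.cast_le]
      omega
    rw [this, Set.encard_coe_eq_coe_finsetCard, Finset.card_range]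

theorem hasSum_decMass (P : Marginal) : HasSum P.decMass 1 := by
  have h1 : ∫⁻ x, ENNReal.ofReal (P.mass x) ∂Measure.count
      = ∫⁻ x, ENNReal.ofReal (P.decMass x) ∂Measure.count := by
    rw [lintegral_eq_lintegral_meas_lt _ (ae_of_all _ P.nonneg) (by fun_prop),
      lintegral_eq_lintegral_meas_lt _ (ae_of_all _ P.decMass_nonneg) (by fun_prop)]
    refine lintegral_congr fun t => ?_
    rw [Measure.count_apply (MeasurableSet.of_discrete),
      Measure.count_apply (MeasurableSet.of_discrete)]
    simp_rw [lt_decMass_iff, encard_setOf_succ_le]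
  rw [lintegral_count, lintegral_count,
    ← ENNReal.ofReal_tsum_of_nonneg P.nonneg P.hasSum.summable, P.hasSum.tsum_eq,
    ENNReal.ofReal_one] at h1
  have h2 : Summable P.decMass := by
    have := ENNReal.summable_toReal (f := fun x => ENNReal.ofReal (P.decMass x))
      (by rw [← h1]; exact ENNReal.one_ne_top)
    simpa only [ENNReal.toReal_ofReal (P.decMass_nonneg _)] using this
  rw [← ENNReal.ofReal_tsum_of_nonneg P.decMass_nonneg h2] at h1
  have h3 : ∑' x, P.decMass x = 1 := by
    have := congrArg ENNReal.toReal h1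
    rwa [ENNReal.toReal_ofReal (tsum_nonneg P.decMass_nonneg), ENNReal.toReal_one, eq_comm]
      at this
  rw [← h3]
  exact h2.hasSum

/-- The decreasing rearrangement `P↓` of `P`. -/
noncomputable def dec (P : Marginal) : Marginal where
  mass := P.decMass
  nonneg := P.decMass_nonneg
  hasSum := P.hasSum_decMass

/-- The mixture `l P + (1 - l) R`. -/
noncomputable def mix (l : ℝ) (hl : l ∈ Set.Icc (0 : ℝ) 1) (P R : Marginal) : Marginal where
  mass x := l * P.mass x + (1 - l) * R.mass x
  nonneg x := add_nonneg (mul_nonneg hl.1 (P.nonneg x))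
    (mul_nonneg (sub_nonneg.2 hl.2) (R.nonneg x))
  hasSum := by simpa using (P.hasSum.mul_left l).add (R.hasSum.mul_left (1 - l))

/-- The marginal with masses `ν {x}`. -/
noncomputable def ofMeasure (ν : Measure ℕ) [IsProbabilityMeasure ν] : Marginal where
  mass x := ν.real {x}
  nonneg _ := measureReal_nonneg
  hasSum := by
    have h : ∑' x : ℕ, ν {x} = 1 := by
      have := Measure.tsum_indicator_apply_singleton ν Set.univ MeasurableSet.univ
      simpa using this
    have h2 := ENNReal.hasSum_toReal (f := fun x : ℕ => ν {x}) (by rw [h]; simp)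
    rwa [← ENNReal.tsum_toReal_eq (fun x => measure_ne_top ν _), h, ENNReal.toReal_one] at h2

/-- `∑_{x = 1}^{k} P↓(x)`. -/
noncomputable def topSum (P : Marginal) (k : ℕ) : ℝ := ∑ i ∈ Finset.range k, P.decMass i

/-- The minimum error probability of list decoding with list size `L` without side information,
`1 - ∑_{x = 1}^{L} Q↓(x)`. -/
noncomputable def listError (Q : Marginal) (L : ℕ) : ℝ := 1 - Q.topSum L

theorem topSum_succ (P : Marginal) (k : ℕ) : P.topSum (k + 1) = P.topSum k + P.decMass k :=
  Finset.sum_range_succ _ _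

theorem topSum_le_one (P : Marginal) (k : ℕ) : P.topSum k ≤ 1 :=
  sum_le_hasSum _ (fun i _ => P.decMass_nonneg i) P.hasSum_decMass

end Marginal

/-! ### Postulates on the information measure -/

/-- Invariance under rearrangement: `φ(P) = φ(P↓)`. -/
def IsSymmetric (φ : Marginal → ℝ≥0∞) : Prop := ∀ P, φ P = φ P.dec

/-- Lower semicontinuity along pointwise convergent sequences of marginals. -/
def IsLowerSemicont (φ : Marginal → ℝ≥0∞) : Prop :=
  ∀ (P : Marginal) (p : ℕ → Marginal),
    (∀ x, Tendsto (fun n => (p n).mass x) atTop (𝓝 (P.mass x))) →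
      φ P ≤ liminf (fun n => φ (p n)) atTop

def IsConcave (φ : Marginal → ℝ≥0∞) : Prop :=
  ∀ (P R : Marginal) (l : ℝ) (hl : l ∈ Set.Icc (0 : ℝ) 1),
    ENNReal.ofReal l * φ P + ENNReal.ofReal (1 - l) * φ R ≤ φ (Marginal.mix l hl P R)

/-- Strictness of the concavity inequality at distinct points with finite values; at a point of
infinite value a strict inequality is impossible. -/
def IsStrictConcave (φ : Marginal → ℝ≥0∞) : Prop :=
  ∀ (P R : Marginal) (l : ℝ) (hl : l ∈ Set.Ioo (0 : ℝ) 1), P ≠ R → φ P ≠ ∞ → φ R ≠ ∞ →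
    ENNReal.ofReal l * φ P + ENNReal.ofReal (1 - l) * φ R
      < φ (Marginal.mix l (Set.Ioo_subset_Icc_self hl) P R)

/-! ### Fano distributions -/

section Fano

variable (Q : Marginal) (L : ℕ) (ε : ℝ)

/-- The weight `V(j)`, `j ≥ 1`. -/
noncomputable def fanoV (j : ℕ) : ℝ :=
  if j ≤ L then ((1 - ε) - Q.topSum (j - 1)) / ((L : ℝ) - j + 1) else 1

/-- The weight `W(k)`, `L ≤ k ≤ ∞`. -/
noncomputable def fanoW (k : ℕ∞) : ℝ :=
  if k = ⊤ then 0
  else if k = L then -1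
  else (Q.topSum k.toNat - (1 - ε)) / ((k.toNat : ℝ) - L)

/-- `J = min {j ≥ 1 | Q↓(j) < V(j)}`. -/
noncomputable def fanoJ : ℕ := sInf {j : ℕ | 1 ≤ j ∧ Q.decMass (j - 1) < fanoV Q L ε j}

/-- `K₁ = sup {L ≤ k < ∞ | W(k) < Q↓(k)}`, possibly infinite. -/
noncomputable def fanoK₁ : ℕ∞ :=
  sSup {k : ℕ∞ | ∃ n : ℕ, k = n ∧ L ≤ n ∧ fanoW Q L ε n < Q.decMass (n - 1)}

/-- `K₂ = max {L ≤ k ≤ N L | W(k) < Q↓(k)}`, where `N` is the size of the side-information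
alphabet. -/
noncomputable def fanoK₂ (N : ℕ) : ℕ :=
  sSup {k : ℕ | L ≤ k ∧ k ≤ N * L ∧ fanoW Q L ε k < Q.decMass (k - 1)}

/-- The masses of the Fano distributions, for a given upper cut-off `K`: at the symbol `x + 1`
the value is `Q↓(x + 1)` if `x + 1 < J` or `K < x + 1`, it is `V(J)` if `J ≤ x + 1 ≤ L`, and it
is `W(K)` if `L < x + 1 ≤ K`. -/
noncomputable def fanoMass (K : ℕ∞) (x : ℕ) : ℝ :=
  if x + 1 < fanoJ Q L ε ∨ K < ((x + 1 : ℕ) : ℕ∞) then Q.decMass x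
  else if x + 1 ≤ L then fanoV Q L ε (fanoJ Q L ε)
  else fanoW Q L ε K

theorem fanoJ_spec (hL : 1 ≤ L) :
    1 ≤ fanoJ Q L ε ∧ fanoJ Q L ε ≤ L + 1 ∧
      Q.decMass (fanoJ Q L ε - 1) < fanoV Q L ε (fanoJ Q L ε) := by
  have hmem : L + 1 ∈ {j : ℕ | 1 ≤ j ∧ Q.decMass (j - 1) < fanoV Q L ε j} := by
    refine ⟨by omega, ?_⟩
    have h2 := Q.topSum_le_one 2
    have h3 : Q.topSum 2 = Q.decMass 0 + Q.decMass 1 := by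
      simp [Marginal.topSum, Finset.sum_range_succ]
    have h4 := Q.decMass_antitone (Nat.zero_le 1)
    have h5 := Q.decMass_antitone hL
    have h6 : fanoV Q L ε (L + 1) = 1 := by simp [fanoV]
    rw [h6, Nat.add_sub_cancel]
    linarith
  have h := Nat.sInf_mem ⟨_, hmem⟩
  exact ⟨h.1, Nat.sInf_le hmem, h.2⟩

theorem fanoV_nonneg (hL : 1 ≤ L) : 0 ≤ fanoV Q L ε (fanoJ Q L ε) :=
  (Q.decMass_nonneg _).trans (fanoJ_spec Q L ε hL).2.2.le

theorem sum_fanoMass_low (hL : 1 ≤ L) (hε : ε ≤ Q.listError L) (K : ℕ∞) (hK : (L : ℕ∞) ≤ K) :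
    ∑ i ∈ Finset.range L, fanoMass Q L ε K i = 1 - ε := by
  obtain ⟨h1, h2, h3⟩ := fanoJ_spec Q L ε hL
  set J := fanoJ Q L ε with hJ
  have hsplit : ∑ i ∈ Finset.range L, fanoMass Q L ε K i
      = Q.topSum (J - 1) + ((L - (J - 1) : ℕ) : ℝ) * fanoV Q L ε J := by
    rw [← Finset.sum_range_add_sum_Ico _ (by omega : J - 1 ≤ L), Marginal.topSum]
    congr 1
    · refine Finset.sum_congr rfl fun i hi => ?_
      rw [Finset.mem_range] at hi
      rw [fanoMass, if_pos (Or.inl (by omega))]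
    · rw [← Nat.card_Ico (J - 1) L, ← nsmul_eq_mul, ← Finset.sum_const]
      refine Finset.sum_congr rfl fun i hi => ?_
      rw [Finset.mem_Ico] at hi
      have hK' : ((i + 1 : ℕ) : ℕ∞) ≤ K := (Nat.cast_le.2 (by omega)).trans hK
      rw [fanoMass, if_neg (by rw [not_or]; exact ⟨by omega, not_lt.2 hK'⟩), if_pos (by omega)]
  rw [hsplit]
  rcases Nat.lt_or_ge L J with hlt | hle
  · have hJL : J = L + 1 := by omega
    have hnot : ¬ (1 ≤ L ∧ Q.decMass (L - 1) < fanoV Q L ε L) := fun hmem =>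
      absurd (show J ≤ L from Nat.sInf_le hmem) (by omega)
    have hV : fanoV Q L ε L ≤ Q.decMass (L - 1) := by
      by_contra hc
      exact hnot ⟨hL, not_le.1 hc⟩
    rw [fanoV, if_pos le_rfl, sub_self, zero_add, div_one] at hV
    have hs := Q.topSum_succ (L - 1)
    rw [Nat.sub_add_cancel hL] at hs
    rw [Marginal.listError] at hε
    rw [hJL, Nat.add_sub_cancel, Nat.sub_self, Nat.cast_zero, zero_mul]
    linarith
  · rw [fanoV, if_pos hle]
    have hc : ((L - (J - 1) : ℕ) : ℝ) = (L : ℝ) - J + 1 := by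
      rw [Nat.cast_sub (by omega), Nat.cast_sub h1]
      push_cast
      ring
    have hpos : (0 : ℝ) < (L : ℝ) - J + 1 := by
      have : (J : ℝ) ≤ L := by exact_mod_cast hle
      linarith
    rw [hc, mul_div_cancel₀ _ hpos.ne']
    ring

theorem fanoW_nat {n : ℕ} (hn : L < n) :
    fanoW Q L ε n = (Q.topSum n - (1 - ε)) / ((n : ℝ) - L) := by
  have h : ¬ ((n : ℕ∞) = L) := by
    rw [Nat.cast_inj]
    omega
  rw [fanoW, if_neg (ENat.natCast_ne_top n), if_neg h, ENat.toNat_natCast]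

/-- The Fano masses with a finite cut-off form a distribution. -/
theorem fanoMass_nat (hL : 1 ≤ L) (hε : ε ≤ Q.listError L) (n : ℕ) (hn : L ≤ n)
    (hS : 1 - ε ≤ Q.topSum n) :
    (∀ x, 0 ≤ fanoMass Q L ε n x) ∧ HasSum (fanoMass Q L ε n) 1 := by
  constructor
  · intro x
    rw [fanoMass]
    split_ifs with h1 h2
    · exact Q.decMass_nonneg x
    · exact fanoV_nonneg Q L ε hL
    · have h1' : ((x + 1 : ℕ) : ℕ∞) ≤ n := not_lt.1 (not_or.1 h1).2
      rw [Nat.cast_le] at h1'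
      have hlt : L < n := by omega
      rw [fanoW_nat Q L ε hlt]
      have : (L : ℝ) < n := by exact_mod_cast hlt
      exact div_nonneg (by linarith) (by linarith)
  · have hlow := sum_fanoMass_low Q L ε hL hε n (Nat.cast_le.2 hn)
    obtain ⟨h1, h2, h3⟩ := fanoJ_spec Q L ε hL
    have hsum : ∑ i ∈ Finset.range n, fanoMass Q L ε n i = Q.topSum n := by
      rw [← Finset.sum_range_add_sum_Ico _ hn, hlow]
      rcases hn.eq_or_lt with rfl | hlt
      · rw [Marginal.listError] at hε
        rw [Finset.Ico_self, Finset.sum_empty]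
        linarith
      · have : ∑ i ∈ Finset.Ico L n, fanoMass Q L ε n i
            = ∑ i ∈ Finset.Ico L n, fanoW Q L ε n := by
          refine Finset.sum_congr rfl fun i hi => ?_
          rw [Finset.mem_Ico] at hi
          have hK' : ((i + 1 : ℕ) : ℕ∞) ≤ n := Nat.cast_le.2 (by omega)
          rw [fanoMass, if_neg (by rw [not_or]; exact ⟨by omega, not_lt.2 hK'⟩),
            if_neg (by omega)]
        have hpos : (L : ℝ) < n := by exact_mod_cast hlt
        rw [this, Finset.sum_const, nsmul_eq_mul, Nat.card_Ico, Nat.cast_sub hn,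
          fanoW_nat Q L ε hlt, mul_div_cancel₀ _ (by linarith)]
        ring
    have hdiff : HasSum (fun i => fanoMass Q L ε n i - Q.decMass i)
        (∑ i ∈ Finset.range n, (fanoMass Q L ε n i - Q.decMass i)) := by
      refine hasSum_sum_of_ne_finset_zero fun i hi => ?_
      rw [Finset.mem_range, not_lt] at hi
      have : (n : ℕ∞) < ((i + 1 : ℕ) : ℕ∞) := Nat.cast_lt.2 (by omega)
      rw [fanoMass, if_pos (Or.inr this), sub_self]
    rw [Finset.sum_sub_distrib, hsum, ← Marginal.topSum, sub_self] at hdiff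
    simpa using hdiff.add Q.hasSum_decMass

/-- If `k + 1` fails the defining inequality of the cut-off, then `1 - ε ≤ ∑_{x ≤ k} Q↓(x)`. -/
theorem le_topSum_of_not_lt {k : ℕ} (hk : L ≤ k)
    (h : ¬ fanoW Q L ε ((k + 1 : ℕ) : ℕ∞) < Q.decMass k) : 1 - ε ≤ Q.topSum k := by
  rw [not_lt, fanoW_nat Q L ε (by omega)] at h
  have hk' : (L : ℝ) ≤ k := by exact_mod_cast hk
  rw [le_div_iff₀ (by push_cast; linarith), Q.topSum_succ] at h
  push_cast at h
  nlinarith [Q.decMass_nonneg k]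

theorem fanoW_self_lt : fanoW Q L ε L < Q.decMass (L - 1) := by
  have : fanoW Q L ε L = -1 := by simp [fanoW]
  rw [this]
  linarith [Q.decMass_nonneg (L - 1)]

theorem fanoK₂_spec (hL : 1 ≤ L) (hε : ε ≤ Q.listError L) (N : ℕ)
    (hN : 1 - Q.topSum (N * L) ≤ ε) :
    L ≤ fanoK₂ Q L ε N ∧ 1 - ε ≤ Q.topSum (fanoK₂ Q L ε N) := by
  have hN1 : 1 ≤ N := by
    by_contra hc
    have hN0 : N = 0 := by omega
    subst hN0
    rw [Nat.zero_mul] at hN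
    have h0 : Q.topSum 0 = 0 := by simp [Marginal.topSum]
    rw [Marginal.listError] at hε
    have hz : Q.topSum L ≤ 0 := by linarith
    have hd0 : Q.decMass 0 ≤ 0 := le_trans (Finset.single_le_sum
      (fun i _ => Q.decMass_nonneg i) (Finset.mem_range.2 hL)) hz
    have hall : ∀ i, Q.decMass i = 0 := fun i =>
      le_antisymm ((Q.decMass_antitone (Nat.zero_le i)).trans hd0) (Q.decMass_nonneg i)
    have := Q.hasSum_decMass
    rw [funext hall] at this
    exact zero_ne_one (hasSum_zero.unique this)
  set A := {k : ℕ | L ≤ k ∧ k ≤ N * L ∧ fanoW Q L ε k < Q.decMass (k - 1)} with hA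
  have hbdd : BddAbove A := ⟨N * L, fun k hk => hk.2.1⟩
  have hLA : L ∈ A := ⟨le_rfl, Nat.le_mul_of_pos_left L hN1, fanoW_self_lt Q L ε⟩
  have hmem : fanoK₂ Q L ε N ∈ A := Nat.sSup_mem ⟨L, hLA⟩ hbdd
  refine ⟨hmem.1, ?_⟩
  rcases hmem.2.1.eq_or_lt with heq | hlt
  · rw [heq]
    linarith
  · refine le_topSum_of_not_lt Q L ε hmem.1 fun hc => ?_
    have : fanoK₂ Q L ε N + 1 ∈ A := ⟨by have := hmem.1; omega, hlt, hc⟩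
    have := le_csSup hbdd this
    change _ ≤ fanoK₂ Q L ε N at this
    omega

theorem le_fanoK₁ : (L : ℕ∞) ≤ fanoK₁ Q L ε :=
  le_sSup ⟨L, rfl, le_rfl, fanoW_self_lt Q L ε⟩

/-- The cut-off `K₁` is infinite only if `ε = 0`. -/
theorem eps_nonpos_of_fanoK₁_top (h : fanoK₁ Q L ε = ⊤) : ε ≤ 0 := by
  by_contra hpos
  rw [not_le] at hpos
  have hlim : Tendsto Q.topSum atTop (𝓝 1) := Q.hasSum_decMass.tendsto_sum_nat
  have hlim0 : Tendsto Q.decMass atTop (𝓝 0) := Q.hasSum_decMass.summable.tendsto_atTop_zero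
  obtain ⟨m, hm⟩ := (hlim.eventually (lt_mem_nhds (by linarith : 1 - ε / 2 < 1))).exists
  have hlim1 : Tendsto (fun k => (m : ℝ) * Q.decMass k) atTop (𝓝 0) := by
    simpa using hlim0.const_mul (m : ℝ)
  obtain ⟨m', hm'⟩ := eventually_atTop.1
    (hlim1.eventually (gt_mem_nhds (by linarith : 0 < ε / 2)))
  have hbig : ((m + m' + L + 1 : ℕ) : ℕ∞) < fanoK₁ Q L ε := by
    rw [h]
    exact ENat.natCast_lt_top _
  obtain ⟨_, ⟨n, rfl, hLn, hn⟩, hlt⟩ := lt_sSup_iff.1 hbig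
  rw [Nat.cast_lt] at hlt
  have hnL : (L : ℝ) < n := by exact_mod_cast (by omega : L < n)
  rw [fanoW_nat Q L ε (by omega), div_lt_iff₀ (by linarith)] at hn
  have h1 : ((n : ℝ) - m) * Q.decMass (n - 1) ≤ Q.topSum n - Q.topSum m := by
    have hmn : m ≤ n := by omega
    rw [Marginal.topSum, Marginal.topSum, ← Finset.sum_Ico_eq_sub _ hmn, ← Nat.cast_sub hmn,
      ← Nat.card_Ico, ← nsmul_eq_mul]
    refine Finset.card_nsmul_le_sum _ _ _ fun i hi => Q.decMass_antitone ?_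
    rw [Finset.mem_Ico] at hi
    omega
  have h2 := hm' (n - 1) (by omega)
  have h3 : 0 ≤ (L : ℝ) * Q.decMass (n - 1) := mul_nonneg (Nat.cast_nonneg _) (Q.decMass_nonneg _)
  nlinarith

theorem fanoMass_top (hL : 1 ≤ L) (hε0 : ε = 0) (hε : ε ≤ Q.listError L) :
    (∀ x, 0 ≤ fanoMass Q L ε ⊤ x) ∧ HasSum (fanoMass Q L ε ⊤) 1 := by
  constructor
  · intro x
    rw [fanoMass]
    split_ifs
    · exact Q.decMass_nonneg x
    · exact fanoV_nonneg Q L ε hL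
    · simp [fanoW]
  · have hlow := sum_fanoMass_low Q L ε hL hε ⊤ le_top
    rw [hε0, sub_zero, ← hε0] at hlow
    rw [← hlow]
    refine hasSum_sum_of_ne_finset_zero fun i hi => ?_
    rw [Finset.mem_range, not_lt] at hi
    have := (fanoJ_spec Q L ε hL).2.1
    rw [fanoMass, if_neg (by rw [not_or]; exact ⟨by omega, not_top_lt⟩), if_neg (by omega)]
    simp [fanoW]

theorem fanoMass_K₁ (hL : 1 ≤ L) (hε0 : 0 ≤ ε) (hε : ε ≤ Q.listError L) :
    (∀ x, 0 ≤ fanoMass Q L ε (fanoK₁ Q L ε) x) ∧ HasSum (fanoMass Q L ε (fanoK₁ Q L ε)) 1 := by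
  rcases eq_or_ne (fanoK₁ Q L ε) ⊤ with h | h
  · rw [h]
    exact fanoMass_top Q L ε hL (le_antisymm (eps_nonpos_of_fanoK₁_top Q L ε h) hε0) hε
  · obtain ⟨n, hn⟩ := ENat.ne_top_iff_exists.1 h
    have hLn := le_fanoK₁ Q L ε
    rw [← hn] at hLn ⊢
    rw [Nat.cast_le] at hLn
    refine fanoMass_nat Q L ε hL hε n hLn (le_topSum_of_not_lt Q L ε hLn fun hc => ?_)
    have : ((n + 1 : ℕ) : ℕ∞) ≤ fanoK₁ Q L ε := le_sSup ⟨n + 1, rfl, by omega, hc⟩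
    rw [← hn, Nat.cast_le] at this
    omega

/-- The type-1 Fano distribution of a system `(Q, L, ε)` with `0 ≤ ε ≤ 1 - ∑_{x ≤ L} Q↓(x)`. -/
noncomputable def fanoType1 (hL : 1 ≤ L) (hε0 : 0 ≤ ε) (hε : ε ≤ Q.listError L) : Marginal where
  mass := fanoMass Q L ε (fanoK₁ Q L ε)
  nonneg := (fanoMass_K₁ Q L ε hL hε0 hε).1
  hasSum := (fanoMass_K₁ Q L ε hL hε0 hε).2

/-- The type-2 Fano distribution of a system `(Q, L, ε)` and a side-information alphabet with
`N` elements, where `1 - ∑_{x ≤ N L} Q↓(x) ≤ ε ≤ 1 - ∑_{x ≤ L} Q↓(x)`. -/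
noncomputable def fanoType2 (N : ℕ) (hL : 1 ≤ L) (hN : 1 - Q.topSum (N * L) ≤ ε)
    (hε : ε ≤ Q.listError L) : Marginal where
  mass := fanoMass Q L ε (fanoK₂ Q L ε N)
  nonneg := (fanoMass_nat Q L ε hL hε _ (fanoK₂_spec Q L ε hL hε N hN).1
    (fanoK₂_spec Q L ε hL hε N hN).2).1
  hasSum := (fanoMass_nat Q L ε hL hε _ (fanoK₂_spec Q L ε hL hε N hN).1
    (fanoK₂_spec Q L ε hL hε N hN).2).2

theorem eps_nonneg_of_range {N : ℕ} (hN : 1 - Q.topSum (N * L) ≤ ε) : 0 ≤ ε :=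
  (sub_nonneg.2 (Q.topSum_le_one _)).trans hN

end Fano

/-! ### Random variables with side information -/

section SideInformation

variable {Ω 𝒴 : Type*} [MeasurableSpace Ω] [MeasurableSpace 𝒴]

/-- The regular conditional distribution `P_{X | Y = y}`. -/
noncomputable def condMarginal (μ : Measure Ω) [IsFiniteMeasure μ] (X : Ω → ℕ) (Y : Ω → 𝒴)
    (y : 𝒴) : Marginal :=
  Marginal.ofMeasure (condDistrib X Y μ y)

/-- The generalized conditional information measure `E[φ(P_{X|Y})]`. -/
noncomputable def condInfo (φ : Marginal → ℝ≥0∞) (μ : Measure Ω) [IsFiniteMeasure μ]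
    (X : Ω → ℕ) (Y : Ω → 𝒴) : ℝ≥0∞ :=
  ∫⁻ ω, φ (condMarginal μ X Y (Y ω)) ∂μ

/-- The minimum average error probability of list decoding with list size `L`: the infimum of
`P{X ∉ f(Y)}` over all `f` whose values are nonempty sets of at most `L` symbols. -/
noncomputable def condListError (L : ℕ) (μ : Measure Ω) (X : Ω → ℕ) (Y : Ω → 𝒴) : ℝ :=
  ⨅ f : 𝒴 → {D : Finset ℕ // 1 ≤ D.card ∧ D.card ≤ L}, μ.real {ω | X ω ∉ (f (Y ω)).1}

/-- `X` and `Y` are random variables and `X` has distribution `Q`. -/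
structure HasMarginal (Q : Marginal) (μ : Measure Ω) (X : Ω → ℕ) (Y : Ω → 𝒴) : Prop where
  measurable_fst : Measurable X
  measurable_snd : Measurable Y
  law : ∀ x, μ.real (X ⁻¹' {x}) = Q.mass x

end SideInformation

universe u v

/-- The supremum of `E[φ(P_{X|Y})]` over all pairs `(X, Y)` of random variables, on any
probability space, such that `X` has distribution `Q`, `Y` takes values in `𝒴`, and the minimum
average error probability of list decoding is at most `ε`. -/
noncomputable def supCondInfo (φ : Marginal → ℝ≥0∞) (Q : Marginal) (L : ℕ) (ε : ℝ)
    (𝒴 : Type v) [MeasurableSpace 𝒴] : ℝ≥0∞ :=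
  sSup {h : ℝ≥0∞ | ∃ (Ω : Type u) (_ : MeasurableSpace Ω) (μ : Measure Ω)
    (_ : IsProbabilityMeasure μ) (X : Ω → ℕ) (Y : Ω → 𝒴),
    HasMarginal Q μ X Y ∧ condListError L μ X Y ≤ ε ∧ h = condInfo φ μ X Y}

/-! A symmetric, concave and lower semicontinuous `φ` is Schur-concave: if the partial sums of `P↓`
dominate those of `R↓`, then `φ P ≤ φ R`. For partial sums that agree from some point on, `R↓` is a
convex combination of permutations of `P↓` (Hardy–Littlewood–Pólya, by separation from the convex
hull), and the general case is a limit of such.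

*Upper bound.* Choose `n = |𝒴| L` symbols that contain `L` largest masses of each conditional law
`P_{X|Y=y}`, and sort each of these laws in decreasing order on the chosen symbols. This changes
neither `φ` nor the list error, but turns `Q` into a mixture `M` whose `L` largest masses add up to
at least `1 - ε`, which agrees with `Q` off the chosen symbols, and for which the partial sums of
`M↓` dominate those of `Q↓`. These three properties already imply that they dominate those of `P₂↓`,
for the type-2 Fano distribution `P₂`. Hence `𝔥_φ(X | Y) ≤ φ M ≤ φ P₂` by Jensen's inequality and
Schur-concavity; for strictly concave `φ`, equality in both steps forces `P_{X|Y}↓ = P₂↓`.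

*Attainment.* `P₂` and `Q↓` differ only on the block `J, …, K₂`, where `P₂` takes just two values.
So `Q↓` is a convex combination of rearrangements of `P₂` inside this block. By Carathéodory's
theorem affinely independent rearrangements suffice; their number is at most the dimension plus one,
and at most the number of ways to place the two values. Taking them as conditional laws attains
the bound whenever `𝒴` has room for them.
-/

/-! ### Rearrangements -/

namespace Marginal

section TopSymbol

variable (P : Marginal)

theorem exists_forall_notMem_mass_le (s : Finset ℕ) :
    ∃ x ∉ s, ∀ y ∉ s, P.mass y ≤ P.mass x := by
  by_cases h : ∃ y ∉ s, 0 < P.mass y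
  · obtain ⟨y, hys, hy⟩ := h
    have hfin : {x | P.mass y ≤ P.mass x}.Finite := by
      have := P.hasSum.summable.tendsto_cofinite_zero.eventually (gt_mem_nhds hy)
      simpa [Filter.eventually_cofinite] using this
    obtain ⟨x, hx, hmax⟩ := Set.exists_max_image ({x | P.mass y ≤ P.mass x} \ ↑s) P.mass
      (hfin.subset Set.sdiff_subset) ⟨y, le_refl (P.mass y), hys⟩
    refine ⟨x, hx.2, fun z hz => ?_⟩
    by_cases hyz : P.mass y ≤ P.mass z
    · exact hmax z ⟨hyz, hz⟩
    · exact (not_le.1 hyz).le.trans hx.1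
  · push Not at h
    obtain ⟨x, hx⟩ := Infinite.exists_notMem_finset s
    exact ⟨x, hx, fun y hy => (h y hy).trans (P.nonneg x)⟩

/-- A symbol of the `(n + 1)`-st largest mass, chosen greedily: it has the largest mass among the
symbols different from `topSymbol 0, …, topSymbol (n - 1)`. -/
noncomputable def topSymbol (n : ℕ) : ℕ :=
  (P.exists_forall_notMem_mass_le (Finset.univ.image fun i : Fin n => topSymbol i)).choose
termination_by n
decreasing_by all_goals exact i.2

theorem topSymbol_spec (n : ℕ) :
    P.topSymbol n ∉ (Finset.range n).image P.topSymbol ∧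
      ∀ y ∉ (Finset.range n).image P.topSymbol, P.mass y ≤ P.mass (P.topSymbol n) := by
  have himage : (Finset.univ.image fun i : Fin n => P.topSymbol i)
      = (Finset.range n).image P.topSymbol := by
    ext x
    simp [Fin.exists_iff]
  rw [← himage, topSymbol]
  exact (P.exists_forall_notMem_mass_le _).choose_spec

theorem topSymbol_injective : P.topSymbol.Injective := by
  refine Function.Injective.of_lt_imp_ne fun i j hij h => (P.topSymbol_spec j).1 ?_
  exact Finset.mem_image.2 ⟨i, Finset.mem_range.2 hij, h⟩

theorem card_image_topSymbol (n : ℕ) : ((Finset.range n).image P.topSymbol).card = n := by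
  rw [Finset.card_image_of_injective _ P.topSymbol_injective, Finset.card_range]

theorem mass_topSymbol_antitone : Antitone fun n => P.mass (P.topSymbol n) := by
  refine antitone_nat_of_succ_le fun n => (P.topSymbol_spec n).2 _ fun h => ?_
  obtain ⟨i, hi, h⟩ := Finset.mem_image.1 h
  have := P.topSymbol_injective h
  rw [Finset.mem_range] at hi
  omega

theorem mass_topSymbol (n : ℕ) : P.mass (P.topSymbol n) = P.decMass n := by
  refine le_antisymm (le_csSup (P.bddAbove_decMass n) ?_)
    (csSup_le ⟨0, P.zero_mem_decMass n⟩ fun t ht => ?_)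
  · have hsub : (↑((Finset.range (n + 1)).image P.topSymbol) : Set ℕ)
        ⊆ {x | P.mass (P.topSymbol n) ≤ P.mass x} := by
      intro x hx
      obtain ⟨i, hi, rfl⟩ := Finset.mem_image.1 (Finset.mem_coe.1 hx)
      exact P.mass_topSymbol_antitone (by rw [Finset.mem_range] at hi; omega)
    have := Set.encard_le_encard hsub
    rwa [Set.encard_coe_eq_coe_finsetCard, card_image_topSymbol] at this
  · have hsub : ¬ {x | t ≤ P.mass x} ⊆ ↑((Finset.range n).image P.topSymbol) := fun hsub => by
      have := ht.trans (Set.encard_le_encard hsub)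
      rw [Set.encard_coe_eq_coe_finsetCard, card_image_topSymbol, Nat.cast_le] at this
      omega
    obtain ⟨x, hx, hx'⟩ := Set.not_subset.1 hsub
    exact le_trans hx ((P.topSymbol_spec n).2 x hx')

theorem sum_le_topSum (B : Finset ℕ) : ∑ x ∈ B, P.mass x ≤ P.topSum B.card := by
  induction h : B.card generalizing B with
  | zero =>
    rw [Finset.card_eq_zero] at h
    simp [h, topSum]
  | succ k ih =>
    obtain ⟨x, hx, hmin⟩ := Finset.exists_min_image B P.mass (Finset.card_pos.1 (by omega))
    rw [← Finset.sum_erase_add _ _ hx, topSum_succ]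
    refine add_le_add (ih _ (by rw [Finset.card_erase_of_mem hx]; omega)) ?_
    refine le_csSup (P.bddAbove_decMass k) ?_
    change ((k + 1 : ℕ) : ℕ∞) ≤ _
    rw [← h, ← Set.encard_coe_eq_coe_finsetCard]
    exact Set.encard_le_encard hmin

theorem exists_sum_eq_topSum (k : ℕ) :
    ∃ B : Finset ℕ, B.card = k ∧ ∑ x ∈ B, P.mass x = P.topSum k := by
  refine ⟨(Finset.range k).image P.topSymbol, P.card_image_topSymbol k, ?_⟩
  rw [Finset.sum_image P.topSymbol_injective.injOn]
  exact Finset.sum_congr rfl fun i _ => P.mass_topSymbol i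

theorem sum_range_le_topSum (k : ℕ) : ∑ x ∈ Finset.range k, P.mass x ≤ P.topSum k := by
  simpa using P.sum_le_topSum (Finset.range k)

theorem topSum_mono : Monotone P.topSum := fun _ _ h =>
  Finset.sum_le_sum_of_subset_of_nonneg (Finset.range_mono h) fun i _ _ => P.decMass_nonneg i

end TopSymbol

theorem eq_of_mass_le {P R : Marginal} (h : ∀ x, P.mass x ≤ R.mass x) : P = R := by
  have hzero := (hasSum_zero_iff_of_nonneg fun x => sub_nonneg.2 (h x)).1
    (by simpa using R.hasSum.sub P.hasSum)
  ext x
  exact (sub_eq_zero.1 (congrFun hzero x)).symm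

/-- The image of `P` under an injection of the alphabet. -/
noncomputable def push (P : Marginal) (σ : ℕ → ℕ) (hσ : σ.Injective) : Marginal where
  mass := Function.extend σ P.mass 0
  nonneg x := by
    by_cases hx : ∃ i, σ i = x
    · obtain ⟨i, rfl⟩ := hx
      rw [hσ.extend_apply]
      exact P.nonneg i
    · rw [Function.extend_apply' _ _ _ hx, Pi.zero_apply]
  hasSum := by
    have h0 : ∀ x ∉ Set.range σ, Function.extend σ P.mass 0 x = 0 := fun x hx => by
      rw [Function.extend_apply' _ _ _ fun hc => hx hc, Pi.zero_apply]
    rw [← hσ.hasSum_iff h0, Function.extend_comp hσ]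
    exact P.hasSum

section Push

variable {P R : Marginal} {σ : ℕ → ℕ}

theorem push_apply (hσ : σ.Injective) (i : ℕ) : (P.push σ hσ).mass (σ i) = P.mass i :=
  hσ.extend_apply _ _ i

theorem push_apply_of_notMem_range (hσ : σ.Injective) {x : ℕ} (hx : x ∉ Set.range σ) :
    (P.push σ hσ).mass x = 0 :=
  Function.extend_apply' _ _ _ fun hc => hx hc

theorem push_eq_of_forall_mass_eq (hσ : σ.Injective) (h : ∀ i, R.mass (σ i) = P.mass i) :
    P.push σ hσ = R := by
  refine eq_of_mass_le fun x => ?_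
  by_cases hx : x ∈ Set.range σ
  · obtain ⟨i, rfl⟩ := hx
    rw [push_apply, h]
  · rw [push_apply_of_notMem_range hσ hx]
    exact R.nonneg x

theorem dec_push (hσ : σ.Injective) : (P.push σ hσ).dec = P.dec := by
  ext i
  refine eq_of_forall_lt_iff fun t => ?_
  change t < (P.push σ hσ).decMass i ↔ t < P.decMass i
  rcases lt_or_ge t 0 with ht | ht
  · exact iff_of_true (ht.trans_le (decMass_nonneg _ i)) (ht.trans_le (decMass_nonneg _ i))
  · have himage : {x | t < (P.push σ hσ).mass x} = σ '' {x | t < P.mass x} := by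
      ext x
      by_cases hx : x ∈ Set.range σ
      · obtain ⟨j, rfl⟩ := hx
        simp only [Set.mem_ofPred_eq, push_apply, hσ.mem_set_image]
      · refine iff_of_false ?_ fun hx' => hx (Set.image_subset_range _ _ hx')
        simpa only [Set.mem_ofPred_eq, push_apply_of_notMem_range hσ hx, not_lt] using ht
    rw [lt_decMass_iff, lt_decMass_iff, himage, hσ.encard_image]

end Push

theorem push_dec_topSymbol (P : Marginal) : P.dec.push P.topSymbol P.topSymbol_injective = P :=
  push_eq_of_forall_mass_eq _ P.mass_topSymbol

/-- The distribution with masses `P (σ x)`. -/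
noncomputable def perm (P : Marginal) (σ : Equiv.Perm ℕ) : Marginal where
  mass x := P.mass (σ x)
  nonneg _ := P.nonneg _
  hasSum := σ.hasSum_iff.2 P.hasSum

theorem dec_perm (P : Marginal) (σ : Equiv.Perm ℕ) : (P.perm σ).dec = P.dec := by
  have h : (P.perm σ).push σ σ.injective = P := push_eq_of_forall_mass_eq _ fun _ => rfl
  rw [← dec_push σ.injective, h]

theorem topSum_congr {P R : Marginal} (h : P.dec = R.dec) (k : ℕ) : P.topSum k = R.topSum k :=
  Finset.sum_congr rfl fun i _ => congrFun (congrArg mass h) i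

end Marginal

theorem IsSymmetric.eq_of_dec_eq {φ : Marginal → ℝ≥0∞} (hsymm : IsSymmetric φ) {P R : Marginal}
    (h : P.dec = R.dec) : φ P = φ R := by
  rw [hsymm P, hsymm R, h]

/-! ### Jensen's inequality -/

section Mixtures

variable {ι : Type*} {s : Finset ι} {w : ι → ℝ} {P : ι → Marginal} {M : Marginal} {i : ι}

/-- `M` is the mixture `∑ i ∈ s, w i • P i` with probability weights `w`. A relation rather than a
function of `(w, P)`, since the weights of a mixture are certified only on `s`. -/
structure Marginal.IsMixture (s : Finset ι) (w : ι → ℝ) (P : ι → Marginal) (M : Marginal) :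
    Prop where
  weight_nonneg : ∀ i ∈ s, 0 ≤ w i
  sum_weight : ∑ i ∈ s, w i = 1
  mass_eq : ∀ x, M.mass x = ∑ i ∈ s, w i * (P i).mass x

namespace Marginal

theorem exists_isMixture (hw : ∀ i ∈ s, 0 ≤ w i) (hsum : ∑ i ∈ s, w i = 1) (P : ι → Marginal) :
    ∃ M, IsMixture s w P M :=
  ⟨{ mass := fun x => ∑ i ∈ s, w i * (P i).mass x
     nonneg := fun x => Finset.sum_nonneg fun i hi => mul_nonneg (hw i hi) ((P i).nonneg x)
     hasSum := by simpa [hsum] using hasSum_sum (s := s) fun i _ => (P i).hasSum.mul_left (w i) },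
    hw, hsum, fun _ => rfl⟩

theorem mix_self (l : ℝ) (hl : l ∈ Set.Icc (0 : ℝ) 1) (P : Marginal) : mix l hl P P = P := by
  ext x
  simp only [mix]
  ring

namespace IsMixture

theorem weight_mem_Icc (h : IsMixture s w P M) (hi : i ∈ s) : w i ∈ Set.Icc (0 : ℝ) 1 :=
  ⟨h.weight_nonneg i hi, h.sum_weight ▸ Finset.single_le_sum h.weight_nonneg hi⟩

theorem sum_mass (h : IsMixture s w P M) (D : Finset ℕ) :
    ∑ x ∈ D, M.mass x = ∑ i ∈ s, w i * ∑ x ∈ D, (P i).mass x := by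
  simp only [h.mass_eq, Finset.mul_sum]
  exact Finset.sum_comm

theorem sum_ofReal_mul_const (h : IsMixture s w P M) (c : ℝ≥0∞) :
    ∑ i ∈ s, ENNReal.ofReal (w i) * c = c := by
  rw [← Finset.sum_mul, ← ENNReal.ofReal_sum_of_nonneg h.weight_nonneg, h.sum_weight,
    ENNReal.ofReal_one, one_mul]

theorem exists_eq_mix [DecidableEq ι] (h : IsMixture s w P M) (hi : i ∈ s) (h1 : w i < 1) :
    ∃ (M' : Marginal) (hw : w i ∈ Set.Icc (0 : ℝ) 1),
      IsMixture (s.erase i) (fun j => w j / (1 - w i)) P M' ∧ M = mix (w i) hw (P i) M' := by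
  have hpos : 0 < 1 - w i := sub_pos.2 h1
  have hsum : ∑ j ∈ s.erase i, w j / (1 - w i) = 1 := by
    rw [← Finset.sum_div, div_eq_one_iff_eq hpos.ne', ← h.sum_weight,
      ← Finset.sum_erase_add _ _ hi, add_sub_cancel_right]
  obtain ⟨M', hM'⟩ := exists_isMixture
    (fun j hj => div_nonneg (h.weight_nonneg j (Finset.mem_of_mem_erase hj)) hpos.le) hsum P
  refine ⟨M', h.weight_mem_Icc hi, hM', ?_⟩
  ext x
  simp only [mix]
  rw [h.mass_eq, hM'.mass_eq, ← Finset.add_sum_erase _ _ hi, Finset.mul_sum]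
  congr 1
  refine Finset.sum_congr rfl fun j _ => ?_
  field_simp

theorem weight_eq_zero_of_weight_eq_one [DecidableEq ι] (h : IsMixture s w P M) (hi : i ∈ s)
    (h1 : w i = 1) : ∀ j ∈ s.erase i, w j = 0 := by
  have hsum := h.sum_weight
  rw [← Finset.add_sum_erase _ _ hi, h1, add_eq_left] at hsum
  exact (Finset.sum_eq_zero_iff_of_nonneg fun j hj =>
    h.weight_nonneg j (Finset.mem_of_mem_erase hj)).1 hsum

theorem eq_of_weight_eq_one (h : IsMixture s w P M) (hi : i ∈ s) (h1 : w i = 1) :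
    M = P i := by
  classical
  ext x
  rw [h.mass_eq, ← Finset.add_sum_erase _ _ hi, h1, one_mul, Finset.sum_eq_zero, add_zero]
  intro j hj
  rw [h.weight_eq_zero_of_weight_eq_one hi h1 j hj, zero_mul]

end IsMixture

end Marginal

open Marginal

variable {φ : Marginal → ℝ≥0∞}

theorem add_sum_erase_ofReal_div [DecidableEq ι] (hi : i ∈ s) (h1 : w i < 1) (f : ι → ℝ≥0∞) :
    ENNReal.ofReal (w i) * f i
        + ENNReal.ofReal (1 - w i) * ∑ j ∈ s.erase i, ENNReal.ofReal (w j / (1 - w i)) * f j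
      = ∑ j ∈ s, ENNReal.ofReal (w j) * f j := by
  have hpos : 0 < 1 - w i := sub_pos.2 h1
  rw [← Finset.add_sum_erase _ _ hi, Finset.mul_sum]
  congr 1
  refine Finset.sum_congr rfl fun j _ => ?_
  rw [← mul_assoc, ← ENNReal.ofReal_mul hpos.le, mul_div_cancel₀ _ hpos.ne']

theorem IsConcave.sum_le (hconc : IsConcave φ) (h : IsMixture s w P M) :
    ∑ i ∈ s, ENNReal.ofReal (w i) * φ (P i) ≤ φ M := by
  classical
  induction s using Finset.induction_on generalizing w M with
  | empty => simp
  | insert a s ha ih =>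
    have hmem := Finset.mem_insert_self a s
    rcases (h.weight_mem_Icc hmem).2.eq_or_lt with h1 | h1
    · have h0 := h.weight_eq_zero_of_weight_eq_one hmem h1
      rw [Finset.erase_insert ha] at h0
      rw [h.eq_of_weight_eq_one hmem h1, Finset.sum_insert ha, h1, ENNReal.ofReal_one, one_mul,
        Finset.sum_eq_zero fun j hj => by rw [h0 j hj, ENNReal.ofReal_zero, zero_mul], add_zero]
    · obtain ⟨M', hw, hM', rfl⟩ := h.exists_eq_mix hmem h1
      refine le_trans ?_ (hconc _ _ _ hw)
      rw [← add_sum_erase_ofReal_div hmem h1]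
      rw [Finset.erase_insert ha] at hM' ⊢
      gcongr
      exact ih hM'

theorem IsConcave.eq_of_mix_le (hconc : IsConcave φ) (hstrict : IsStrictConcave φ)
    {P R : Marginal} {l : ℝ} (hl : l ∈ Set.Ioo (0 : ℝ) 1)
    (hfin : φ (mix l (Set.Ioo_subset_Icc_self hl) P R) ≠ ∞)
    (hle : φ (mix l (Set.Ioo_subset_Icc_self hl) P R)
      ≤ ENNReal.ofReal l * φ P + ENNReal.ofReal (1 - l) * φ R) : P = R := by
  have hsum := ne_top_of_le_ne_top hfin (hconc P R l (Set.Ioo_subset_Icc_self hl))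
  rw [Ne, ENNReal.add_eq_top, not_or] at hsum
  by_contra hne
  refine (hstrict P R l hl hne (fun hP => ?_) fun hR => ?_).not_ge hle
  · exact hsum.1 (by rw [hP, ENNReal.mul_top (by simpa using hl.1)])
  · exact hsum.2 (by rw [hR, ENNReal.mul_top (by simpa using hl.2)])

theorem IsConcave.eq_of_le_sum (hconc : IsConcave φ) (hstrict : IsStrictConcave φ)
    (h : IsMixture s w P M) (hfin : φ M ≠ ∞)
    (hle : φ M ≤ ∑ i ∈ s, ENNReal.ofReal (w i) * φ (P i)) (hi : i ∈ s) (h0 : w i ≠ 0) :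
    P i = M := by
  classical
  rcases (h.weight_mem_Icc hi).2.eq_or_lt with h1 | h1
  · exact (h.eq_of_weight_eq_one hi h1).symm
  · obtain ⟨M', _, hM', rfl⟩ := h.exists_eq_mix hi h1
    rw [← add_sum_erase_ofReal_div hi h1] at hle
    have heq := hconc.eq_of_mix_le hstrict ⟨(h.weight_nonneg i hi).lt_of_ne' h0, h1⟩ hfin
      (hle.trans (by gcongr; exact hconc.sum_le hM'))
    rw [← heq, mix_self]

end Mixtures

/-! ### Partial sums -/

section PartialSums

variable {d f : ℕ → ℝ} {a b c m n : ℕ} {v x : ℝ}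

theorem sub_mul_le_sum_range (hd : Antitone d) (hab : a ≤ b) :
    ((b : ℝ) - a) * d b ≤ ∑ i ∈ Finset.range b, d i - ∑ i ∈ Finset.range a, d i := by
  rw [← Finset.sum_Ico_eq_sub _ hab, ← Nat.cast_sub hab, ← Nat.card_Ico, ← nsmul_eq_mul]
  exact Finset.card_nsmul_le_sum _ _ _ fun i hi => hd (Finset.mem_Ico.1 hi).2.le

theorem sum_range_le_sub_mul (hd : Antitone d) (hab : a ≤ b) :
    ∑ i ∈ Finset.range b, d i - ∑ i ∈ Finset.range a, d i ≤ ((b : ℝ) - a) * d a := by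
  rw [← Finset.sum_Ico_eq_sub _ hab, ← Nat.cast_sub hab, ← Nat.card_Ico, ← nsmul_eq_mul]
  exact Finset.sum_le_card_nsmul _ _ _ fun i hi => hd (Finset.mem_Ico.1 hi).1

theorem sum_range_eq_of_const (ham : a ≤ m) (h : ∀ i, a ≤ i → i < m → f i = v) :
    ∑ i ∈ Finset.range m, f i = ∑ i ∈ Finset.range a, f i + ((m : ℝ) - a) * v := by
  rw [← Finset.sum_range_add_sum_Ico _ ham, ← Nat.cast_sub ham, ← Nat.card_Ico, ← nsmul_eq_mul,
    ← Finset.sum_const]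
  congr 1
  exact Finset.sum_congr rfl fun i hi => h i (Finset.mem_Ico.1 hi).1 (Finset.mem_Ico.1 hi).2

/-- Partial sums of an antitone sequence are concave, so they dominate an affine piece as soon as
they do so at its endpoints. -/
theorem sum_range_add_le_of_endpoints (hd : Antitone d) (ham : a ≤ m) (hmc : m ≤ c)
    (h : ∀ i, a ≤ i → i < c → f i = v)
    (ha : ∑ i ∈ Finset.range a, f i + x ≤ ∑ i ∈ Finset.range (a + b), d i)
    (hc : ∑ i ∈ Finset.range c, f i + x ≤ ∑ i ∈ Finset.range (c + b), d i) :
    ∑ i ∈ Finset.range m, f i + x ≤ ∑ i ∈ Finset.range (m + b), d i := by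
  have hm := sum_range_eq_of_const ham fun i h1 h2 => h i h1 (by omega)
  have hm' := sum_range_eq_of_const hmc fun i h1 h2 => h i (by omega) h2
  have h1 := sub_mul_le_sum_range hd (by omega : a + b ≤ m + b)
  have h2 := sum_range_le_sub_mul hd (by omega : m + b ≤ c + b)
  push_cast at h1 h2
  have ham' : (a : ℝ) ≤ m := by exact_mod_cast ham
  have hmc' : (m : ℝ) ≤ c := by exact_mod_cast hmc
  rcases le_total v (d (m + b)) with hv | hv
  · have := mul_le_mul_of_nonneg_left hv (sub_nonneg.2 ham')
    linarith
  · have := mul_le_mul_of_nonneg_left hv (sub_nonneg.2 hmc')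
    linarith

theorem sum_le_sum_range_card (hd : AntitoneOn d (Set.Iio n)) {D : Finset ℕ}
    (hD : ∀ i ∈ D, i < n) : ∑ i ∈ D, d i ≤ ∑ i ∈ Finset.range D.card, d i := by
  induction D using Finset.induction_on_max with
  | empty => simp
  | insert i D hi ih =>
    have hcard : D.card ≤ i := by
      simpa using Finset.card_le_card fun j hj => Finset.mem_range.2 (hi j hj)
    have hin := hD i (Finset.mem_insert_self i D)
    have hiD : i ∉ D := fun h => (hi i h).false
    rw [Finset.sum_insert hiD, Finset.card_insert_of_notMem hiD, Finset.sum_range_succ, add_comm]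
    exact add_le_add (ih fun j hj => hD j (Finset.mem_insert_of_mem hj))
      (hd (hcard.trans_lt hin) hin hcard)

theorem exists_sum_le_sum_range_add_sum_range (hf : AntitoneOn f (Set.Iio n))
    (hf' : Antitone fun i => f (n + i)) (B : Finset ℕ) :
    ∃ m ≤ n, ∃ b, m + b = B.card ∧
      ∑ i ∈ B, f i ≤ ∑ i ∈ Finset.range m, f i + ∑ i ∈ Finset.range b, f (n + i) := by
  have hlow : ∀ i ∈ B.filter (· < n), i < n := fun i hi => (Finset.mem_filter.1 hi).2
  have hhigh : ∀ i ∈ B.filter (¬ · < n), n + (i - n) = i := fun i hi =>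
    Nat.add_sub_cancel' (not_lt.1 (Finset.mem_filter.1 hi).2)
  have hinj : Set.InjOn (· - n) (B.filter (¬ · < n)) := fun i hi j hj hij => by
    rw [← hhigh i hi, ← hhigh j hj]
    exact congrArg (n + ·) hij
  refine ⟨_, ?_, _, Finset.card_filter_add_card_filter_not (s := B) (· < n), ?_⟩
  · simpa using Finset.card_le_card fun i hi => Finset.mem_range.2 (hlow i hi)
  rw [← Finset.sum_filter_add_sum_filter_not B (· < n)]
  refine add_le_add (sum_le_sum_range_card hf hlow) ?_
  obtain ⟨k, hk⟩ := ((B.filter (¬ · < n)).image (· - n)).exists_nat_subset_range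
  have := sum_le_sum_range_card (hf'.antitoneOn (Set.Iio k)) fun i hi => Finset.mem_range.1 (hk hi)
  rw [Finset.sum_image hinj, Finset.card_image_of_injOn hinj] at this
  exact (Finset.sum_congr rfl fun i hi => by rw [hhigh i hi]).trans_le this

theorem sum_mul_le_sum_mul_of_sum_range_le {p q : ℕ → ℝ} (hd : AntitoneOn d (Set.Iio n))
    (hle : ∀ k ≤ n, ∑ i ∈ Finset.range k, q i ≤ ∑ i ∈ Finset.range k, p i)
    (heq : ∑ i ∈ Finset.range n, p i = ∑ i ∈ Finset.range n, q i) :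
    ∑ i ∈ Finset.range n, d i * q i ≤ ∑ i ∈ Finset.range n, d i * p i := by
  have hsub : ∑ i ∈ Finset.range n, d i * p i - ∑ i ∈ Finset.range n, d i * q i
      = ∑ i ∈ Finset.range n, d i • (p i - q i) := by
    simp only [smul_eq_mul, mul_sub, Finset.sum_sub_distrib]
  rw [← sub_nonneg, hsub, Finset.sum_range_by_parts, Finset.sum_sub_distrib, heq, sub_self,
    smul_zero, zero_sub, neg_nonneg]
  refine Finset.sum_nonpos fun i hi => ?_
  rw [Finset.mem_range] at hi
  rw [Finset.sum_sub_distrib]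
  exact mul_nonpos_of_nonpos_of_nonneg
    (sub_nonpos.2 (hd (Set.mem_Iio.2 (by omega)) (Set.mem_Iio.2 (by omega)) i.le_succ))
    (sub_nonneg.2 (hle _ (by omega)))

/-- The Hardy–Littlewood–Pólya theorem. If `q` were separated from the convex hull by a linear
functional, then sorting its coefficients would contradict the rearrangement inequality. -/
theorem mem_convexHull_perm_of_sum_range_le {p q : ℕ → ℝ} (hq : AntitoneOn q (Set.Iio n))
    (hle : ∀ k ≤ n, ∑ i ∈ Finset.range k, q i ≤ ∑ i ∈ Finset.range k, p i)
    (heq : ∑ i ∈ Finset.range n, p i = ∑ i ∈ Finset.range n, q i) :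
    (fun i : Fin n => q i) ∈
      convexHull ℝ (Set.range fun (σ : Equiv.Perm (Fin n)) (i : Fin n) => p (σ i)) := by
  by_contra hmem
  obtain ⟨f, u, hfu, hu⟩ := geometric_hahn_banach_closed_point (convex_convexHull ℝ _)
    ((Set.finite_range _).isClosed_convexHull ℝ) hmem
  obtain ⟨c, hc⟩ : ∃ c : Fin n → ℝ, ∀ r : Fin n → ℝ, f r = ∑ i, c i * r i :=
    ⟨_, fun r => ((f : (Fin n → ℝ) →ₗ[ℝ] ℝ).pi_apply_eq_sum_univ r).trans
      (Finset.sum_congr rfl fun i _ => mul_comm _ _)⟩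
  set τ := Tuple.sort (-c)
  have hτ : Antitone (c ∘ τ) := fun i j hij => neg_le_neg_iff.1 (Tuple.monotone_sort (-c) hij)
  have hsort : ∑ i, c (τ i) * q i ≤ ∑ i, c (τ i) * p i := by
    have hext : ∀ i : Fin n, Function.extend Fin.val (c ∘ τ) 0 (i : ℕ) = c (τ i) :=
      Fin.val_injective.extend_apply _ _
    have hanti : AntitoneOn (Function.extend Fin.val (c ∘ τ) 0) (Set.Iio n) := by
      intro i hi j hj hij
      have := hτ (show (⟨i, hi⟩ : Fin n) ≤ ⟨j, hj⟩ from hij)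
      simpa only [← hext, Function.comp_apply] using this
    have := sum_mul_le_sum_mul_of_sum_range_le hanti hle heq
    simpa only [Finset.sum_range, hext] using this
  have hmono : Monovary (fun i : Fin n => q i) (c ∘ τ) :=
    Antitone.monovary (fun i j hij => hq i.2 j.2 hij) hτ
  refine (hu.trans_le ?_).not_gt (hfu _ (subset_convexHull ℝ _ ⟨τ.symm, rfl⟩))
  calc f (fun i => q i) = ∑ i : Fin n, q i * (c ∘ τ) (τ.symm i) := by
        simp only [hc, Function.comp_apply, Equiv.apply_symm_apply, mul_comm]
    _ ≤ ∑ i : Fin n, q i * (c ∘ τ) i := hmono.sum_mul_comp_perm_le_sum_mul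
    _ ≤ ∑ i, c (τ i) * p i := by simpa only [mul_comm, Function.comp_apply] using hsort
    _ = f (fun i => p (τ.symm i)) := by
        rw [hc, ← Equiv.sum_comp τ fun i => c i * p (τ.symm i)]
        simp only [Equiv.symm_apply_apply]

end PartialSums

/-! ### Majorization -/

/-- The permutation of `ℕ` that acts as `σ` on the block `a, …, a + m - 1` and fixes the other
numbers. -/
noncomputable def blockPerm (a : ℕ) {m : ℕ} (σ : Equiv.Perm (Fin m)) : Equiv.Perm ℕ :=
  σ.viaEmbedding (Fin.valEmbedding.trans (addLeftEmbedding a))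

section BlockPerm

variable {a m : ℕ} (σ : Equiv.Perm (Fin m))

theorem blockPerm_add (i : Fin m) : blockPerm a σ (a + i) = a + σ i :=
  σ.viaEmbedding_apply (Fin.valEmbedding.trans (addLeftEmbedding a)) i

theorem blockPerm_of_notMem {x : ℕ} (hx : x ∉ Finset.Ico a (a + m)) : blockPerm a σ x = x := by
  refine σ.viaEmbedding_apply_of_notMem _ x ?_
  rintro ⟨i, rfl⟩
  exact hx (Finset.mem_Ico.2 ⟨Nat.le_add_right a i, Nat.add_lt_add_left i.2 a⟩)

end BlockPerm

namespace Marginal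

section Majorization

variable {P Q : Marginal}

theorem hasSum_of_eq_compl {f : ℕ → ℝ} {s : Finset ℕ} (h : ∀ i ∉ s, f i = Q.mass i)
    (hs : ∑ i ∈ s, f i = ∑ i ∈ s, Q.mass i) : HasSum f 1 := by
  have hdiff : HasSum (fun i => f i - Q.mass i) (∑ i ∈ s, (f i - Q.mass i)) :=
    hasSum_sum_of_ne_finset_zero fun i hi => sub_eq_zero.2 (h i hi)
  rw [Finset.sum_sub_distrib, hs, sub_self] at hdiff
  simpa using hdiff.add Q.hasSum

theorem sum_eq_of_eq_compl {s : Finset ℕ} (h : ∀ i ∉ s, P.mass i = Q.mass i) :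
    ∑ i ∈ s, P.mass i = ∑ i ∈ s, Q.mass i := by
  have hdiff : HasSum (fun i => P.mass i - Q.mass i) (∑ i ∈ s, (P.mass i - Q.mass i)) :=
    hasSum_sum_of_ne_finset_zero fun i hi => sub_eq_zero.2 (h i hi)
  have := hdiff.unique (P.hasSum.sub Q.hasSum)
  rwa [Finset.sum_sub_distrib, sub_self, sub_eq_zero] at this

theorem exists_isMixture_perm_blockPerm {a m : ℕ}
    (hQ : AntitoneOn Q.mass (Set.Ico a (a + m)))
    (hPQ : ∀ i ∉ Finset.Ico a (a + m), P.mass i = Q.mass i)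
    (hle : ∀ k ≤ m, ∑ i ∈ Finset.range k, Q.mass (a + i) ≤ ∑ i ∈ Finset.range k, P.mass (a + i)) :
    ∃ (κ : Type) (_ : Fintype κ) (w : κ → ℝ) (σ : κ → Equiv.Perm (Fin m)),
      AffineIndependent ℝ (fun k (i : Fin m) => P.mass (a + σ k i)) ∧
        IsMixture Finset.univ w (fun k => P.perm (blockPerm a (σ k))) Q := by
  have heq := sum_eq_of_eq_compl hPQ
  simp only [Finset.sum_Ico_eq_sum_range, Nat.add_sub_cancel_left] at heq
  have hanti : AntitoneOn (fun i => Q.mass (a + i)) (Set.Iio m) := fun i hi j hj hij =>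
    hQ ⟨Nat.le_add_right a i, Nat.add_lt_add_left hi a⟩
      ⟨Nat.le_add_right a j, Nat.add_lt_add_left hj a⟩ (Nat.add_le_add_left hij a)
  obtain ⟨κ, _, z, w, hz, hind, hw, hsum, hzQ⟩ := eq_pos_convex_span_of_mem_convexHull
    (mem_convexHull_perm_of_sum_range_le hanti hle heq)
  choose σ hσ using fun k => hz ⟨k, rfl⟩
  refine ⟨κ, inferInstance, w, σ, by rwa [funext hσ], fun k _ => (hw k).le, hsum, fun x => ?_⟩
  by_cases hx : x ∈ Finset.Ico a (a + m)
  · obtain ⟨i, rfl⟩ : ∃ i : Fin m, x = a + i := by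
      rw [Finset.mem_Ico] at hx
      exact ⟨⟨x - a, by omega⟩, (Nat.add_sub_cancel' hx.1).symm⟩
    have := congrFun hzQ i
    simp only [Finset.sum_apply, Pi.smul_apply, smul_eq_mul, ← hσ] at this
    simp only [perm, blockPerm_add, this]
  · simp only [perm, blockPerm_of_notMem _ hx, ← Finset.sum_mul, hsum, one_mul, hPQ x hx]

end Majorization

section Capped

/-- The truncation used to approximate `P` by distributions with the tail of `Q`: before `n` its
partial sums are those of `P`, capped at the `n`-th partial sum of `Q`; from `n` on its masses are
those of `Q`. -/
noncomputable def capMass (P Q : Marginal) (n k : ℕ) : ℝ :=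
  if k < n then
    min (∑ i ∈ Finset.range (k + 1), P.mass i) (∑ i ∈ Finset.range n, Q.mass i)
      - min (∑ i ∈ Finset.range k, P.mass i) (∑ i ∈ Finset.range n, Q.mass i)
  else Q.mass k

variable (P Q : Marginal) {n : ℕ}

theorem capMass_nonneg (n k : ℕ) : 0 ≤ capMass P Q n k := by
  rw [capMass]
  split_ifs
  · rw [sub_nonneg, Finset.sum_range_succ]
    exact min_le_min_right _ (le_add_of_nonneg_right (P.nonneg k))
  · exact Q.nonneg k

theorem sum_range_capMass {k : ℕ} (hk : k ≤ n) :
    ∑ i ∈ Finset.range k, capMass P Q n i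
      = min (∑ i ∈ Finset.range k, P.mass i) (∑ i ∈ Finset.range n, Q.mass i) := by
  have h : ∀ i ∈ Finset.range k, capMass P Q n i
      = min (∑ j ∈ Finset.range (i + 1), P.mass j) (∑ j ∈ Finset.range n, Q.mass j)
        - min (∑ j ∈ Finset.range i, P.mass j) (∑ j ∈ Finset.range n, Q.mass j) := fun i hi =>
    if_pos ((Finset.mem_range.1 hi).trans_le hk)
  rw [Finset.sum_congr rfl h,
    Finset.sum_range_sub fun i => min (∑ j ∈ Finset.range i, P.mass j) _, Finset.range_zero,
    Finset.sum_empty, min_eq_left (Finset.sum_nonneg fun i _ => Q.nonneg i), sub_zero]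

theorem tendsto_capMass (k : ℕ) :
    Tendsto (fun n => capMass P Q n k) atTop (𝓝 (P.mass k)) := by
  have hP : ∀ k, ∑ i ∈ Finset.range k, P.mass i ≤ 1 := fun k =>
    sum_le_hasSum _ (fun i _ => P.nonneg i) P.hasSum
  have hlim : ∀ k, Tendsto (fun n => min (∑ i ∈ Finset.range k, P.mass i)
      (∑ i ∈ Finset.range n, Q.mass i)) atTop (𝓝 (∑ i ∈ Finset.range k, P.mass i)) := fun k => by
    have := (tendsto_const_nhds (x := ∑ i ∈ Finset.range k, P.mass i)).min
      Q.hasSum.tendsto_sum_nat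
    rwa [min_eq_left (hP k)] at this
  have hdiff := (hlim (k + 1)).sub (hlim k)
  rw [Finset.sum_range_succ, add_sub_cancel_left] at hdiff
  refine hdiff.congr' ?_
  filter_upwards [eventually_gt_atTop k] with n hn
  rw [capMass, if_pos hn, Finset.sum_range_succ]

variable {P Q}

theorem exists_mass_eq_capMass
    (hle : ∑ i ∈ Finset.range n, Q.mass i ≤ ∑ i ∈ Finset.range n, P.mass i) :
    ∃ R : Marginal, R.mass = capMass P Q n := by
  refine ⟨⟨capMass P Q n, capMass_nonneg P Q n, hasSum_of_eq_compl (s := Finset.range n)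
    (fun i hi => if_neg (by rwa [Finset.mem_range] at hi)) ?_⟩, rfl⟩
  rw [sum_range_capMass P Q le_rfl, min_eq_right hle]

end Capped

end Marginal

open Marginal

section Schur

variable {φ : Marginal → ℝ≥0∞} {P Q : Marginal}

theorem le_of_sum_range_le_of_eq_tail (hsymm : IsSymmetric φ) (hconc : IsConcave φ) {n : ℕ}
    (hQ : AntitoneOn Q.mass (Set.Iio n)) (htail : ∀ i, n ≤ i → P.mass i = Q.mass i)
    (hle : ∀ k ≤ n, ∑ i ∈ Finset.range k, Q.mass i ≤ ∑ i ∈ Finset.range k, P.mass i) :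
    φ P ≤ φ Q := by
  obtain ⟨κ, _, w, σ, -, hmix⟩ := exists_isMixture_perm_blockPerm (P := P) (Q := Q) (a := 0)
    (m := n) (hQ.mono fun i hi => by simpa using hi.2)
    (fun i hi => htail i (by simpa using hi)) (by simpa only [zero_add] using hle)
  have := hconc.sum_le hmix
  simpa only [hsymm.eq_of_dec_eq (P.dec_perm _), hmix.sum_ofReal_mul_const] using this

theorem le_of_sum_range_le (hsymm : IsSymmetric φ) (hconc : IsConcave φ)
    (hlsc : IsLowerSemicont φ) (hQ : Antitone Q.mass)
    (hle : ∀ k, ∑ i ∈ Finset.range k, Q.mass i ≤ ∑ i ∈ Finset.range k, P.mass i) :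
    φ P ≤ φ Q := by
  choose R hR using fun n => exists_mass_eq_capMass (hle n)
  have hRQ : ∀ n, φ (R n) ≤ φ Q := fun n => by
    refine le_of_sum_range_le_of_eq_tail hsymm hconc (n := n) (hQ.antitoneOn _)
      (fun i hi => by rw [hR]; exact if_neg (not_lt.2 hi)) fun k hk => ?_
    rw [hR, sum_range_capMass P Q hk]
    exact le_min (hle k)
      (Finset.sum_le_sum_of_subset_of_nonneg (Finset.range_mono hk) fun i _ _ => Q.nonneg i)
  calc φ P ≤ liminf (fun n => φ (R n)) atTop :=
        hlsc P R fun x => by simpa only [hR] using tendsto_capMass P Q x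
    _ ≤ liminf (fun _ : ℕ => φ Q) atTop := liminf_le_liminf (Eventually.of_forall hRQ)
    _ = φ Q := liminf_const _

theorem le_of_topSum_le (hsymm : IsSymmetric φ) (hconc : IsConcave φ)
    (hlsc : IsLowerSemicont φ) (hle : ∀ k, Q.topSum k ≤ P.topSum k) : φ P ≤ φ Q := by
  rw [hsymm P, hsymm Q]
  exact le_of_sum_range_le hsymm hconc hlsc Q.decMass_antitone hle

theorem dec_eq_of_topSum_le (hsymm : IsSymmetric φ) (hconc : IsConcave φ)
    (hlsc : IsLowerSemicont φ) (hstrict : IsStrictConcave φ)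
    (hle : ∀ k, Q.topSum k ≤ P.topSum k) (hfin : φ Q ≠ ∞) (hφ : φ P = φ Q) :
    P.dec = Q.dec := by
  have hhalf : (1 / 2 : ℝ) ∈ Set.Ioo (0 : ℝ) 1 := by norm_num
  have hmix : φ (mix (1 / 2) (Set.Ioo_subset_Icc_self hhalf) P.dec Q.dec) ≤ φ Q := by
    rw [hsymm Q]
    refine le_of_sum_range_le hsymm hconc hlsc Q.decMass_antitone fun k => ?_
    have := hle k
    simp only [mix, Finset.sum_add_distrib, ← Finset.mul_sum]
    change Q.topSum k ≤ 1 / 2 * P.topSum k + (1 - 1 / 2) * Q.topSum k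
    linarith
  refine hconc.eq_of_mix_le hstrict hhalf (ne_top_of_le_ne_top hfin hmix) (hmix.trans_eq ?_)
  rw [← hsymm, ← hsymm, hφ, ← add_mul, ← ENNReal.ofReal_add (by norm_num) (by norm_num),
    add_sub_cancel, ENNReal.ofReal_one, one_mul]

end Schur

/-! ### Shape of the Fano distributions -/

namespace Marginal

variable {P R : Marginal}

theorem topSum_eq_of_antitone (hP : Antitone P.mass) (k : ℕ) :
    P.topSum k = ∑ i ∈ Finset.range k, P.mass i := by
  refine le_antisymm ?_ (P.sum_range_le_topSum k)
  obtain ⟨B, rfl, hB⟩ := P.exists_sum_eq_topSum k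
  obtain ⟨n, hn⟩ := B.exists_nat_subset_range
  rw [← hB]
  exact sum_le_sum_range_card (hP.antitoneOn (Set.Iio n)) fun i hi => Finset.mem_range.1 (hn hi)

theorem topSum_add_sub_le {m n : ℕ} (hmn : m ≤ n) (b : ℕ) :
    P.topSum m + (P.topSum (n + b) - P.topSum n) ≤ P.topSum (m + b) := by
  simp only [topSum, Finset.sum_range_add, add_sub_cancel_left]
  gcongr with i
  exact P.decMass_antitone (by omega)

theorem dec_eq_of_topSum_eq (h : ∀ k, P.topSum k = R.topSum k) : P.dec = R.dec := by
  ext i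
  have hi := h (i + 1)
  rw [topSum_succ, topSum_succ, h i] at hi
  exact add_left_cancel hi

end Marginal

/-- The first `L` masses `f` of a Fano distribution built from `Q`: equal to `Q↓` on the first
`a = J - 1` symbols, then constantly `V ≥ Q↓(J)`, with sum `c = 1 - ε`. -/
structure IsFanoHead (Q : Marginal) (a L : ℕ) (V c : ℝ) (f : ℕ → ℝ) : Prop where
  le_L : a ≤ L
  eq_decMass : ∀ i < a, f i = Q.decMass i
  eq_V : ∀ i, a ≤ i → i < L → f i = V
  sum_eq : ∑ i ∈ Finset.range L, f i = c
  decMass_le_V : a < L → Q.decMass a ≤ V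
  V_le_decMass : a < L → ∀ i < a, V ≤ Q.decMass i

/-- The masses `f` of a Fano distribution built from `Q` with a finite upper cut-off `K`: a head of
length `L`, then constantly `W` up to `K`, and equal to `Q↓` from there on. -/
structure IsFano (Q : Marginal) (a L K : ℕ) (V W c : ℝ) (f : ℕ → ℝ) : Prop
    extends IsFanoHead Q a L V c f where
  le_K : L ≤ K
  eq_W : ∀ i, L ≤ i → i < K → f i = W
  W_le_decMass : ∀ i, L ≤ i → i < K → W ≤ Q.decMass i
  eq_tail : ∀ i, K ≤ i → f i = Q.decMass i
  sum_K_eq : ∑ i ∈ Finset.range K, f i = Q.topSum K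

namespace IsFanoHead

variable {Q : Marginal} {a L : ℕ} {V c : ℝ} {f : ℕ → ℝ}

theorem decMass_le (h : IsFanoHead Q a L V c f) {i j : ℕ} (hij : i ≤ j) (hi : i < L) :
    Q.decMass j ≤ f i := by
  rcases lt_or_ge i a with hia | hia
  · rw [h.eq_decMass i hia]
    exact Q.decMass_antitone hij
  · rw [h.eq_V i hia hi]
    exact (Q.decMass_antitone (hia.trans hij)).trans (h.decMass_le_V (by omega))

theorem antitoneOn (h : IsFanoHead Q a L V c f) : AntitoneOn f (Set.Iio L) := by
  intro i hi j hj hij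
  rcases lt_or_ge j a with hja | hja
  · rw [h.eq_decMass j hja]
    exact h.decMass_le hij hi
  · rw [h.eq_V j hja hj]
    rcases lt_or_ge i a with hia | hia
    · rw [h.eq_decMass i hia]
      exact h.V_le_decMass (hja.trans_lt hj) i hia
    · rw [h.eq_V i hia hi]

theorem sum_range_eq_topSum (h : IsFanoHead Q a L V c f) {m : ℕ} (hm : m ≤ a) :
    ∑ i ∈ Finset.range m, f i = Q.topSum m :=
  Finset.sum_congr rfl fun i hi => h.eq_decMass i ((Finset.mem_range.1 hi).trans_le hm)

theorem topSum_le_sum_range (h : IsFanoHead Q a L V c f) {m : ℕ} (hm : m ≤ L) :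
    Q.topSum m ≤ ∑ i ∈ Finset.range m, f i :=
  Finset.sum_le_sum fun _ hi => h.decMass_le le_rfl ((Finset.mem_range.1 hi).trans_le hm)

theorem sum_range_add_le (h : IsFanoHead Q a L V c f) {R : Marginal} {b : ℕ} {x : ℝ}
    (hQ : ∀ m ≤ a, Q.topSum m + x ≤ R.topSum (m + b)) (hL : c + x ≤ R.topSum (L + b))
    {m : ℕ} (hm : m ≤ L) : ∑ i ∈ Finset.range m, f i + x ≤ R.topSum (m + b) := by
  rcases le_total m a with hma | hma
  · rw [h.sum_range_eq_topSum hma]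
    exact hQ m hma
  · refine sum_range_add_le_of_endpoints R.decMass_antitone hma hm h.eq_V ?_ ?_
    · rw [h.sum_range_eq_topSum le_rfl]
      exact hQ a le_rfl
    · rw [h.sum_eq]
      exact hL

end IsFanoHead

namespace IsFano

variable {Q R : Marginal} {a L K : ℕ} {V W c : ℝ} {f : ℕ → ℝ}

theorem antitoneOn_Iio (h : IsFano Q a L K V W c f) : AntitoneOn f (Set.Iio K) := by
  intro i hi j hj hij
  rcases lt_or_ge j L with hjL | hjL
  · exact h.antitoneOn (hij.trans_lt hjL) hjL hij
  · rw [h.eq_W j hjL hj]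
    rcases lt_or_ge i L with hiL | hiL
    · exact (h.W_le_decMass j hjL hj).trans (h.decMass_le hij hiL)
    · rw [h.eq_W i hiL hi]

theorem antitone_of_decMass_le (h : IsFano Q a L K V W c f) (hW : L < K → Q.decMass K ≤ W) :
    Antitone f := by
  intro i j hij
  rcases lt_or_ge j K with hj | hj
  · exact h.antitoneOn_Iio (hij.trans_lt hj) hj hij
  rw [h.eq_tail j hj]
  rcases lt_or_ge i K with hi | hi
  · rcases lt_or_ge i L with hiL | hiL
    · exact h.decMass_le hij hiL
    · rw [h.eq_W i hiL hi]
      exact (Q.decMass_antitone hj).trans (hW (hiL.trans_lt hi))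
  · rw [h.eq_tail i hi]
    exact Q.decMass_antitone hij

theorem sum_range_eq_topSum_of_le (h : IsFano Q a L K V W c f) {m : ℕ} (hm : K ≤ m) :
    ∑ i ∈ Finset.range m, f i = Q.topSum m := by
  rw [Marginal.topSum, ← Finset.sum_range_add_sum_Ico _ hm, h.sum_K_eq,
    ← Finset.sum_range_add_sum_Ico Q.decMass hm, Marginal.topSum]
  congr 1
  exact Finset.sum_congr rfl fun i hi => h.eq_tail i (Finset.mem_Ico.1 hi).1

theorem topSum_le_sum (h : IsFano Q a L K V W c f) (m : ℕ) :
    Q.topSum m ≤ ∑ i ∈ Finset.range m, f i := by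
  rcases le_total m L with hmL | hmL
  · exact h.topSum_le_sum_range hmL
  rcases le_total K m with hKm | hKm
  · exact (h.sum_range_eq_topSum_of_le hKm).ge
  have hK := h.sum_K_eq
  rw [Marginal.topSum, ← Finset.sum_range_add_sum_Ico _ hKm,
    ← Finset.sum_range_add_sum_Ico Q.decMass hKm] at hK
  have hIco : ∑ i ∈ Finset.Ico m K, f i ≤ ∑ i ∈ Finset.Ico m K, Q.decMass i := by
    refine Finset.sum_le_sum fun i hi => ?_
    obtain ⟨hmi, hiK⟩ := Finset.mem_Ico.1 hi
    rw [h.eq_W i (hmL.trans hmi) hiK]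
    exact h.W_le_decMass i (hmL.trans hmi) hiK
  rw [Marginal.topSum]
  linarith

theorem sum_range_add_le_topSum (h : IsFano Q a L K V W c f) (hQ : ∀ k, Q.topSum k ≤ R.topSum k)
    {b : ℕ} (hL : c + (Q.topSum (K + b) - Q.topSum K) ≤ R.topSum (L + b)) {m : ℕ} (hm : m ≤ K) :
    ∑ i ∈ Finset.range m, f i + (Q.topSum (K + b) - Q.topSum K) ≤ R.topSum (m + b) := by
  rcases le_total m L with hmL | hmL
  · exact h.sum_range_add_le (fun k hk =>
      (Marginal.topSum_add_sub_le (hk.trans (h.le_L.trans h.le_K)) b).trans (hQ _)) hL hmL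
  · refine sum_range_add_le_of_endpoints R.decMass_antitone hmL hm h.eq_W ?_ ?_
    · rw [h.sum_eq]
      exact hL
    · rw [h.sum_K_eq, add_sub_cancel]
      exact hQ _

theorem topSum_le_of_decMass_le (h : IsFano Q a L K V W c f) {P : Marginal} (hP : P.mass = f)
    (hW : L < K → Q.decMass K ≤ W) (hQ : ∀ k, Q.topSum k ≤ R.topSum k) (hc : c ≤ R.topSum L)
    (k : ℕ) : P.topSum k ≤ R.topSum k := by
  subst hP
  rw [Marginal.topSum_eq_of_antitone (h.antitone_of_decMass_le hW)]
  rcases le_total k K with hk | hk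
  · simpa using h.sum_range_add_le_topSum (b := 0) hQ (by simpa using hc) hk
  · rw [h.sum_range_eq_topSum_of_le hk]
    exact hQ k

theorem topSum_le_of_forall_add_le (h : IsFano Q a L K V W c f) {P : Marginal} (hP : P.mass = f)
    (hQ : ∀ k, Q.topSum k ≤ R.topSum k)
    (hb : ∀ b, c + (Q.topSum (K + b) - Q.topSum K) ≤ R.topSum (L + b)) (k : ℕ) :
    P.topSum k ≤ R.topSum k := by
  subst hP
  obtain ⟨B, rfl, hB⟩ := P.exists_sum_eq_topSum k
  have htail : ∀ i, P.mass (K + i) = Q.decMass (K + i) := fun i => h.eq_tail _ (by omega)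
  obtain ⟨m, hm, b, hcard, hle⟩ := exists_sum_le_sum_range_add_sum_range h.antitoneOn_Iio
    (fun i j hij => by simpa only [htail] using Q.decMass_antitone (Nat.add_le_add_left hij K)) B
  simp only [htail] at hle
  rw [← hB, ← hcard]
  refine hle.trans (le_trans ?_ (h.sum_range_add_le_topSum hQ (hb b) hm))
  rw [Marginal.topSum, Marginal.topSum, Finset.sum_range_add, add_sub_cancel_left]

end IsFano

section FanoMass

variable {Q : Marginal} {L : ℕ} {ε : ℝ}

theorem fanoMass_eq_fanoV {K : ℕ∞} (hK : (L : ℕ∞) ≤ K) {i : ℕ} (hi : fanoJ Q L ε - 1 ≤ i)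
    (hiL : i < L) : fanoMass Q L ε K i = fanoV Q L ε (fanoJ Q L ε) := by
  have hiK : ((i + 1 : ℕ) : ℕ∞) ≤ K := (Nat.cast_le.2 hiL).trans hK
  rw [fanoMass, if_neg (not_or.2 ⟨by omega, not_lt.2 hiK⟩), if_pos (by omega)]

theorem fanoMass_eq_fanoW (hL : 1 ≤ L) {K : ℕ∞} {i : ℕ} (hi : L ≤ i)
    (hiK : ((i + 1 : ℕ) : ℕ∞) ≤ K) : fanoMass Q L ε K i = fanoW Q L ε K := by
  have := (fanoJ_spec Q L ε hL).2.1
  rw [fanoMass, if_neg (not_or.2 ⟨by omega, not_lt.2 hiK⟩), if_neg (by omega)]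

theorem fanoMass_eq_decMass {n i : ℕ} (hi : n ≤ i) : fanoMass Q L ε n i = Q.decMass i :=
  if_pos (Or.inr (Nat.cast_lt.2 (by omega)))

theorem fanoV_le_decMass (hJ : fanoJ Q L ε - 1 < L) {i : ℕ} (hi : i < fanoJ Q L ε - 1) :
    fanoV Q L ε (fanoJ Q L ε) ≤ Q.decMass i := by
  obtain ⟨j, hj⟩ : ∃ j, fanoJ Q L ε = j + 2 := ⟨fanoJ Q L ε - 2, by omega⟩
  have hnot : ¬ (Q.decMass j < fanoV Q L ε (j + 1)) := fun hc => by
    have : fanoJ Q L ε ≤ j + 1 := Nat.sInf_le ⟨by omega, by simpa using hc⟩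
    omega
  refine le_trans ?_ (Q.decMass_antitone (by omega : i ≤ j))
  rw [hj] at hJ ⊢
  have hjL : (j : ℝ) + 2 ≤ L := by exact_mod_cast (by omega : j + 2 ≤ L)
  rw [not_lt, fanoV, if_pos (by omega), Nat.add_sub_cancel,
    div_le_iff₀ (by push_cast; linarith)] at hnot
  rw [fanoV, if_pos (by omega), div_le_iff₀ (by push_cast; linarith),
    show j + 2 - 1 = j + 1 from rfl, Q.topSum_succ]
  push_cast at hnot ⊢
  linarith

theorem decMass_le_fanoW {n : ℕ} (hn : L < n)
    (h : ¬ fanoW Q L ε ((n + 1 : ℕ) : ℕ∞) < Q.decMass n) : Q.decMass n ≤ fanoW Q L ε n := by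
  have hn' : (L : ℝ) < n := by exact_mod_cast hn
  rw [not_lt, fanoW_nat Q L ε (by omega), le_div_iff₀ (by push_cast; linarith),
    Q.topSum_succ] at h
  rw [fanoW_nat Q L ε hn, le_div_iff₀ (by linarith)]
  push_cast at h
  linarith

theorem isFanoHead_fanoMass (hL : 1 ≤ L) (hε : ε ≤ Q.listError L) {K : ℕ∞} (hK : (L : ℕ∞) ≤ K) :
    IsFanoHead Q (fanoJ Q L ε - 1) L (fanoV Q L ε (fanoJ Q L ε)) (1 - ε) (fanoMass Q L ε K) where
  le_L := Nat.sub_le_of_le_add (fanoJ_spec Q L ε hL).2.1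
  eq_decMass i hi := if_pos (Or.inl (by omega))
  eq_V i hi hiL := fanoMass_eq_fanoV hK hi hiL
  sum_eq := sum_fanoMass_low Q L ε hL hε K hK
  decMass_le_V _ := (fanoJ_spec Q L ε hL).2.2.le
  V_le_decMass hJ _ hi := fanoV_le_decMass hJ hi

theorem isFano_fanoMass (hL : 1 ≤ L) (hε : ε ≤ Q.listError L) {n : ℕ} (hn : L ≤ n)
    (hS : 1 - ε ≤ Q.topSum n) (hW : fanoW Q L ε n < Q.decMass (n - 1)) :
    IsFano Q (fanoJ Q L ε - 1) L n (fanoV Q L ε (fanoJ Q L ε)) (fanoW Q L ε n) (1 - ε)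
      (fanoMass Q L ε n) where
  toIsFanoHead := isFanoHead_fanoMass hL hε (Nat.cast_le.2 hn)
  le_K := hn
  eq_W i hi hin := fanoMass_eq_fanoW hL hi (Nat.cast_le.2 hin)
  W_le_decMass i _ hin := hW.le.trans (Q.decMass_antitone (by omega))
  eq_tail i hi := fanoMass_eq_decMass hi
  sum_K_eq := by
    have hF := fanoMass_nat Q L ε hL hε n hn hS
    exact Marginal.sum_eq_of_eq_compl (P := ⟨_, hF.1, hF.2⟩) (Q := Q.dec) fun i hi =>
      fanoMass_eq_decMass (by simpa using hi)

end FanoMass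

section FanoType2

variable {Q : Marginal} {L N : ℕ} {ε : ℝ} (hL : 1 ≤ L) (hN : 1 - Q.topSum (N * L) ≤ ε)
  (hε : ε ≤ Q.listError L)

include hL hN hε in
theorem isGreatest_fanoK₂ :
    IsGreatest {k : ℕ | L ≤ k ∧ k ≤ N * L ∧ fanoW Q L ε k < Q.decMass (k - 1)}
      (fanoK₂ Q L ε N) := by
  have hbdd : BddAbove {k : ℕ | L ≤ k ∧ k ≤ N * L ∧ fanoW Q L ε k < Q.decMass (k - 1)} :=
    ⟨N * L, fun k hk => hk.2.1⟩
  refine ⟨Nat.sSup_mem ?_ hbdd, fun k hk => le_csSup hbdd hk⟩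
  refine Set.nonempty_iff_ne_empty.2 fun hempty => ?_
  have hK := (fanoK₂_spec Q L ε hL hε N hN).1
  rw [fanoK₂, hempty, csSup_empty, Nat.bot_eq_zero] at hK
  omega

theorem isFano_fanoType2 :
    IsFano Q (fanoJ Q L ε - 1) L (fanoK₂ Q L ε N) (fanoV Q L ε (fanoJ Q L ε))
      (fanoW Q L ε (fanoK₂ Q L ε N)) (1 - ε) (fanoType2 Q L ε N hL hN hε).mass :=
  have hK := fanoK₂_spec Q L ε hL hε N hN
  isFano_fanoMass hL hε hK.1 hK.2 (isGreatest_fanoK₂ hL hN hε).1.2.2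

theorem topSum_fanoType2_le {R : Marginal} (hQ : ∀ k, Q.topSum k ≤ R.topSum k)
    (hb : ∀ b, 1 - ε + (Q.topSum (N * L + b) - Q.topSum (N * L)) ≤ R.topSum (L + b)) (k : ℕ) :
    (fanoType2 Q L ε N hL hN hε).topSum k ≤ R.topSum k := by
  have hF := isFano_fanoType2 hL hN hε
  have hK := isGreatest_fanoK₂ hL hN hε
  rcases hK.1.2.1.eq_or_lt with heq | hlt
  · rw [← heq] at hb
    exact hF.topSum_le_of_forall_add_le rfl hQ hb k
  · refine hF.topSum_le_of_decMass_le rfl (fun hLK => decMass_le_fanoW hLK fun hc => ?_) hQ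
      (by simpa using hb 0) k
    exact (hK.2 ⟨hLK.le.trans (Nat.le_succ _), hlt, hc⟩).not_gt (Nat.lt_succ_self _)

theorem topSum_le_fanoType2 (k : ℕ) : Q.topSum k ≤ (fanoType2 Q L ε N hL hN hε).topSum k :=
  ((isFano_fanoType2 hL hN hε).topSum_le_sum k).trans (Marginal.sum_range_le_topSum _ k)

theorem one_sub_le_topSum_fanoType2 : 1 - ε ≤ (fanoType2 Q L ε N hL hN hε).topSum L :=
  (isFano_fanoType2 hL hN hε).sum_eq.symm.trans_le (Marginal.sum_range_le_topSum _ L)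

include hL hN hε in
theorem le_mul_of_range : L ≤ N * L :=
  have hK := (isGreatest_fanoK₂ hL hN hε).1
  hK.1.trans hK.2.1

theorem dec_fanoType2_of_eq (heq : ε = Q.listError L) :
    (fanoType2 Q L ε N hL hN hε).dec = Q.dec := by
  refine Marginal.dec_eq_of_topSum_eq fun k => le_antisymm ?_ (topSum_le_fanoType2 hL hN hε k)
  refine topSum_fanoType2_le hL hN hε (fun _ => le_rfl) (fun b => ?_) k
  rw [heq, Marginal.listError, sub_sub_cancel]
  exact Marginal.topSum_add_sub_le (le_mul_of_range hL hN hε) b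

end FanoType2

section FanoType1

variable {Q R : Marginal} {L : ℕ} {ε : ℝ}

theorem isGreatest_of_fanoK₁_eq {n : ℕ} (h : fanoK₁ Q L ε = n) :
    IsGreatest {k : ℕ | L ≤ k ∧ fanoW Q L ε k < Q.decMass (k - 1)} n := by
  set S : Set ℕ∞ := {k | ∃ n : ℕ, k = n ∧ L ≤ n ∧ fanoW Q L ε n < Q.decMass (n - 1)}
  have : Nonempty S := ⟨L, L, rfl, le_rfl, fanoW_self_lt Q L ε⟩
  have hmem : sSup S ∈ S :=
    ENat.sSup_mem_of_nonempty_of_lt_top (h.trans_lt (ENat.natCast_lt_top n))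
  rw [show sSup S = n from h] at hmem
  obtain ⟨m, hm, hmS⟩ := hmem
  rw [Nat.cast_inj] at hm
  refine ⟨hm ▸ hmS, fun k hk => ?_⟩
  rw [← Nat.cast_le (α := ℕ∞), ← h]
  exact le_sSup ⟨k, rfl, hk⟩

variable (hL : 1 ≤ L) (hε0 : 0 ≤ ε) (hε : ε ≤ Q.listError L) (hQ : ∀ k, Q.topSum k ≤ R.topSum k)
  (hc : 1 - ε ≤ R.topSum L)

include hQ hc

theorem topSum_fanoType1_le_of_eq_top (h : fanoK₁ Q L ε = ⊤) (k : ℕ) :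
    (fanoType1 Q L ε hL hε0 hε).topSum k ≤ R.topSum k := by
  set P := fanoType1 Q L ε hL hε0 hε
  have hhead : IsFanoHead Q _ L _ (1 - ε) P.mass := isFanoHead_fanoMass hL hε (le_fanoK₁ Q L ε)
  have hzero : ∀ i, L ≤ i → P.mass i = 0 := fun i hi => by
    refine (fanoMass_eq_fanoW hL hi (h ▸ le_top)).trans ?_
    rw [h, fanoW, if_pos rfl]
  have hanti : Antitone P.mass := fun i j hij => by
    rcases lt_or_ge j L with hj | hj
    · exact hhead.antitoneOn (hij.trans_lt hj) hj hij
    · exact (hzero j hj).trans_le (P.nonneg i)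
  rw [Marginal.topSum_eq_of_antitone hanti]
  rcases le_total k L with hk | hk
  · simpa using hhead.sum_range_add_le (b := 0) (x := 0) (fun m _ => by simpa using hQ m)
      (by simpa using hc) hk
  · rw [sum_range_eq_of_const hk fun i hi _ => hzero i hi, mul_zero, add_zero, hhead.sum_eq]
    exact hc.trans (R.topSum_mono hk)

theorem topSum_fanoType1_le (k : ℕ) : (fanoType1 Q L ε hL hε0 hε).topSum k ≤ R.topSum k := by
  rcases eq_or_ne (fanoK₁ Q L ε) ⊤ with h | h
  · exact topSum_fanoType1_le_of_eq_top hL hε0 hε hQ hc h k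
  obtain ⟨n, hn⟩ := ENat.ne_top_iff_exists.1 h
  have hK := isGreatest_of_fanoK₁_eq hn.symm
  have hnext : ¬ fanoW Q L ε ((n + 1 : ℕ) : ℕ∞) < Q.decMass n := fun hlt =>
    (hK.2 ⟨hK.1.1.trans (Nat.le_succ n), hlt⟩).not_gt (Nat.lt_succ_self n)
  have hF := isFano_fanoMass hL hε hK.1.1 (le_topSum_of_not_lt Q L ε hK.1.1 hnext) hK.1.2
  exact hF.topSum_le_of_decMass_le (hn ▸ rfl) (fun hlt => decMass_le_fanoW hlt hnext) hQ hc k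

end FanoType1

/-! ### Pairs of random variables with discrete side information -/

theorem ae_comp_iff_forall_measureReal_ne_zero {Ω 𝒴 : Type*} [MeasurableSpace Ω] [Countable 𝒴]
    {μ : Measure Ω} [IsFiniteMeasure μ] {Y : Ω → 𝒴} {p : 𝒴 → Prop} :
    (∀ᵐ ω ∂μ, p (Y ω)) ↔ ∀ y, μ.real (Y ⁻¹' {y}) ≠ 0 → p y := by
  have hset : {ω | ¬ p (Y ω)} = ⋃ y ∈ {y | ¬ p y}, Y ⁻¹' {y} := by
    rw [Set.biUnion_preimage_singleton, Set.preimage_ofPred_eq]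
  rw [ae_iff, hset, measure_biUnion_null_iff (Set.to_countable _)]
  exact forall_congr' fun y => by
    rw [Set.mem_ofPred_eq, not_imp_comm, ← ne_eq, measureReal_ne_zero_iff, ne_eq]

section Pairs

variable {Ω 𝒴 : Type*} [MeasurableSpace Ω] [MeasurableSpace 𝒴]
  [MeasurableSingletonClass 𝒴] {μ : Measure Ω}

theorem measureReal_mul_condMarginal [IsFiniteMeasure μ] {X : Ω → ℕ} {Y : Ω → 𝒴}
    (hX : Measurable X) (hY : Measurable Y) (y : 𝒴) (x : ℕ) :
    μ.real (Y ⁻¹' {y}) * (condMarginal μ X Y y).mass x = μ.real (X ⁻¹' {x} ∩ Y ⁻¹' {y}) := by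
  by_cases h0 : μ (Y ⁻¹' {y}) = 0
  · have h1 : μ (X ⁻¹' {x} ∩ Y ⁻¹' {y}) = 0 := measure_mono_null Set.inter_subset_right h0
    simp only [measureReal_def, h0, h1, ENNReal.toReal_zero, zero_mul]
  · have hmap : (μ.map Y) {y} ≠ 0 := by rwa [Measure.map_apply hY (measurableSet_singleton y)]
    have hmass : (condMarginal μ X Y y).mass x = (condDistrib X Y μ y).real {x} := rfl
    have hset : (fun ω => (Y ω, X ω)) ⁻¹' ({y} ×ˢ {x}) = X ⁻¹' {x} ∩ Y ⁻¹' {y} := by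
      rw [Set.mk_preimage_prod, Set.inter_comm]
    rw [hmass, measureReal_def, measureReal_def, measureReal_def,
      condDistrib_apply_of_ne_zero hX y hmap, Measure.map_apply hY (measurableSet_singleton y),
      Measure.map_apply (hY.prodMk hX)
        ((measurableSet_singleton y).prod (measurableSet_singleton x)),
      hset, ← ENNReal.toReal_mul, ← mul_assoc, ENNReal.mul_inv_cancel h0 (measure_ne_top μ _),
      one_mul]

theorem measureReal_mul_sum_condMarginal [IsFiniteMeasure μ] {X : Ω → ℕ} {Y : Ω → 𝒴}
    (hX : Measurable X) (hY : Measurable Y) (y : 𝒴) (D : Finset ℕ) :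
    μ.real (Y ⁻¹' {y}) * ∑ x ∈ D, (condMarginal μ X Y y).mass x
      = μ.real (X ⁻¹' D ∩ Y ⁻¹' {y}) := by
  have hm (x : ℕ) : MeasurableSet (X ⁻¹' {x}) := hX .of_discrete
  have hsum := sum_measureReal_preimage_singleton (μ := μ.restrict (Y ⁻¹' {y})) D fun x _ => hm x
  simp only [measureReal_restrict_apply (hm _)] at hsum
  rw [measureReal_restrict_apply (hX .of_discrete)] at hsum
  rw [← hsum, Finset.mul_sum]
  exact Finset.sum_congr rfl fun x _ => measureReal_mul_condMarginal hX hY y x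

theorem condMarginal_eq_of_measureReal_inter_eq [IsFiniteMeasure μ] {X : Ω → ℕ} {Y : Ω → 𝒴}
    (hX : Measurable X) (hY : Measurable Y) {P : Marginal} {c : ℝ} {y : 𝒴}
    (hjoint : ∀ x, μ.real (X ⁻¹' {x} ∩ Y ⁻¹' {y}) = c * P.mass x)
    (hy : μ.real (Y ⁻¹' {y}) ≠ 0) : condMarginal μ X Y y = P := by
  have hmul (x : ℕ) : μ.real (Y ⁻¹' {y}) * (condMarginal μ X Y y).mass x = c * P.mass x := by
    rw [measureReal_mul_condMarginal hX hY, hjoint]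
  have hsum := (condMarginal μ X Y y).hasSum.mul_left (μ.real (Y ⁻¹' {y}))
  simp only [hmul] at hsum
  have hc := hsum.unique (P.hasSum.mul_left c)
  rw [mul_one, mul_one] at hc
  ext x
  exact mul_left_cancel₀ hy ((hmul x).trans (by rw [hc]))

variable [Fintype 𝒴]

theorem measureReal_eq_sum_inter_preimage [IsFiniteMeasure μ] {Y : Ω → 𝒴} (hY : Measurable Y)
    (s : Set Ω) : μ.real s = ∑ y, μ.real (s ∩ Y ⁻¹' {y}) := by
  have hm (y : 𝒴) : MeasurableSet (Y ⁻¹' {y}) := hY (measurableSet_singleton y)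
  have hsum := sum_measureReal_preimage_singleton (μ := μ.restrict s) Finset.univ
    fun y _ => hm y
  simp only [measureReal_restrict_apply (hm _), Finset.coe_univ, Set.preimage_univ,
    measureReal_restrict_apply MeasurableSet.univ, Set.univ_inter] at hsum
  simp only [← hsum, Set.inter_comm]

variable [IsProbabilityMeasure μ] {X : Ω → ℕ} {Y : Ω → 𝒴}

theorem HasMarginal.isMixture {Q : Marginal} (h : HasMarginal Q μ X Y) :
    IsMixture Finset.univ (fun y => μ.real (Y ⁻¹' {y})) (condMarginal μ X Y) Q where
  weight_nonneg _ _ := measureReal_nonneg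
  sum_weight := by
    simpa using (measureReal_eq_sum_inter_preimage (μ := μ) h.measurable_snd Set.univ).symm
  mass_eq x := by
    rw [← h.law, measureReal_eq_sum_inter_preimage h.measurable_snd]
    exact Finset.sum_congr rfl fun y _ =>
      (measureReal_mul_condMarginal h.measurable_fst h.measurable_snd y x).symm

theorem condInfo_eq_sum (φ : Marginal → ℝ≥0∞) (hY : Measurable Y) :
    condInfo φ μ X Y = ∑ y, ENNReal.ofReal (μ.real (Y ⁻¹' {y})) * φ (condMarginal μ X Y y) := by
  rw [condInfo, ← lintegral_map (f := fun y => φ (condMarginal μ X Y y)) .of_discrete hY,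
    lintegral_fintype]
  refine Finset.sum_congr rfl fun y _ => ?_
  rw [Measure.map_apply hY (measurableSet_singleton y), ofReal_measureReal, mul_comm]

theorem measureReal_notMem (hX : Measurable X) (hY : Measurable Y) (f : 𝒴 → Finset ℕ) :
    μ.real {ω | X ω ∉ f (Y ω)}
      = 1 - ∑ y, μ.real (Y ⁻¹' {y}) * ∑ x ∈ f y, (condMarginal μ X Y y).mass x := by
  have hinter (y : 𝒴) : {ω | X ω ∈ f (Y ω)} ∩ Y ⁻¹' {y} = X ⁻¹' (f y) ∩ Y ⁻¹' {y} := by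
    ext ω
    exact and_congr_left fun hω => by rw [← (hω : Y ω = y)]; rfl
  have hmeas : MeasurableSet {ω | X ω ∈ f (Y ω)} := by
    have hunion : {ω | X ω ∈ f (Y ω)} = ⋃ y, X ⁻¹' (f y) ∩ Y ⁻¹' {y} := by
      simp only [← hinter, ← Set.inter_iUnion, ← Set.preimage_iUnion, Set.iUnion_of_singleton,
        Set.preimage_univ, Set.inter_univ]
    rw [hunion]
    exact .iUnion fun y => (hX .of_discrete).inter (hY (measurableSet_singleton y))
  refine (probReal_compl_eq_one_sub hmeas).trans ?_
  rw [measureReal_eq_sum_inter_preimage hY]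
  simp only [hinter, measureReal_mul_sum_condMarginal hX hY]

theorem condListError_eq_one_sub_sum {L : ℕ} (hL : 1 ≤ L) (hX : Measurable X)
    (hY : Measurable Y) :
    condListError L μ X Y
      = 1 - ∑ y, μ.real (Y ⁻¹' {y}) * (condMarginal μ X Y y).topSum L := by
  choose B hB hBsum using fun y => (condMarginal μ X Y y).exists_sum_eq_topSum L
  have hbdd : BddBelow (Set.range fun f : 𝒴 → {D : Finset ℕ // 1 ≤ D.card ∧ D.card ≤ L} =>
      μ.real {ω | X ω ∉ (f (Y ω)).1}) := ⟨0, by rintro _ ⟨f, rfl⟩; exact measureReal_nonneg⟩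
  have : Nonempty (𝒴 → {D : Finset ℕ // 1 ≤ D.card ∧ D.card ≤ L}) :=
    ⟨fun _ => ⟨{0}, le_rfl, hL⟩⟩
  refine le_antisymm ?_ (le_ciInf fun f => ?_)
  · refine (ciInf_le hbdd fun y => ⟨B y, by rwa [hB], (hB y).le⟩).trans_eq ?_
    simp only [measureReal_notMem hX hY B, hBsum]
  · rw [measureReal_notMem hX hY fun y => (f y).1]
    gcongr with y
    exact (Marginal.sum_le_topSum _ _).trans (Marginal.topSum_mono _ (f y).2.2)

theorem Marginal.IsMixture.hasMarginal {w : 𝒴 → ℝ} {P : 𝒴 → Marginal} {Q : Marginal}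
    (h : IsMixture Finset.univ w P Q) (hX : Measurable X) (hY : Measurable Y)
    (hjoint : ∀ x y, μ.real (X ⁻¹' {x} ∩ Y ⁻¹' {y}) = w y * (P y).mass x) :
    HasMarginal Q μ X Y where
  measurable_fst := hX
  measurable_snd := hY
  law x := by rw [measureReal_eq_sum_inter_preimage hY, h.mass_eq]; simp only [hjoint]

end Pairs

section Realization

variable {𝒴 : Type v} [Fintype 𝒴] {w : 𝒴 → ℝ} {P : 𝒴 → Marginal} {Q : Marginal}

theorem Marginal.IsMixture.tsum_ofReal_mul_mass (h : IsMixture Finset.univ w P Q) :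
    ∑' z : ℕ × 𝒴, ENNReal.ofReal (w z.2 * (P z.2).mass z.1) = 1 := by
  have hfiber (y : 𝒴) :
      ∑' x, ENNReal.ofReal (w y * (P y).mass x) = ENNReal.ofReal (w y) := by
    have hw := h.weight_nonneg y (Finset.mem_univ y)
    have hsum := (P y).hasSum.mul_left (w y)
    rw [← ENNReal.ofReal_tsum_of_nonneg (fun x => mul_nonneg hw ((P y).nonneg x)) hsum.summable,
      hsum.tsum_eq, mul_one]
  rw [ENNReal.tsum_prod', ENNReal.tsum_comm, tsum_fintype]
  simp only [hfiber]
  rw [← ENNReal.ofReal_sum_of_nonneg h.weight_nonneg, h.sum_weight, ENNReal.ofReal_one]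

theorem Marginal.IsMixture.exists_joint [MeasurableSpace 𝒴] (h : IsMixture Finset.univ w P Q) :
    ∃ (Ω : Type u) (_ : MeasurableSpace Ω) (μ : Measure Ω) (_ : IsProbabilityMeasure μ)
      (X : Ω → ℕ) (Y : Ω → 𝒴), Measurable X ∧ Measurable Y ∧
      ∀ x y, μ.real (X ⁻¹' {x} ∩ Y ⁻¹' {y}) = w y * (P y).mass x := by
  -- `Fin (card 𝒴)` in place of `𝒴` makes the sample space fit into an arbitrary universe.
  let e : ULift.{u} (ℕ × Fin (Fintype.card 𝒴)) ≃ ℕ × 𝒴 :=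
    Equiv.ulift.trans ((Equiv.refl ℕ).prodCongr (Fintype.equivFin 𝒴).symm)
  let g (z : ℕ × 𝒴) : ℝ≥0∞ := ENNReal.ofReal (w z.2 * (P z.2).mass z.1)
  have hg : HasSum (g ∘ e) 1 := by
    rw [← h.tsum_ofReal_mul_mass, ← e.tsum_eq]
    exact ENNReal.summable.hasSum
  let _ : MeasurableSpace (ULift.{u} (ℕ × Fin (Fintype.card 𝒴))) := ⊤
  let p : PMF (ULift.{u} (ℕ × Fin (Fintype.card 𝒴))) := ⟨g ∘ e, hg⟩
  refine ⟨_, ⊤, p.toMeasure, inferInstance, fun ω => (e ω).1, fun ω => (e ω).2,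
    fun _ _ => trivial, fun _ _ => trivial, fun x y => ?_⟩
  have hset : (fun ω => (e ω).1) ⁻¹' {x} ∩ (fun ω => (e ω).2) ⁻¹' {y} = {e.symm (x, y)} := by
    ext ω
    simp only [Set.mem_inter_iff, Set.mem_preimage, Set.mem_singleton_iff, Equiv.eq_symm_apply,
      Prod.ext_iff]
  have hmass : p (e.symm (x, y)) = g (x, y) := congrArg g (e.apply_symm_apply _)
  have hmeas : MeasurableSet {e.symm (x, y)} := trivial
  rw [hset, measureReal_def, PMF.toMeasure_apply_singleton _ _ hmeas, hmass]
  exact ENNReal.toReal_ofReal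
    (mul_nonneg (h.weight_nonneg y (Finset.mem_univ y)) ((P y).nonneg x))

theorem Marginal.IsMixture.exists_hasMarginal [MeasurableSpace 𝒴] [MeasurableSingletonClass 𝒴]
    (h : IsMixture Finset.univ w P Q) :
    ∃ (Ω : Type u) (_ : MeasurableSpace Ω) (μ : Measure Ω) (_ : IsProbabilityMeasure μ)
      (X : Ω → ℕ) (Y : Ω → 𝒴), HasMarginal Q μ X Y ∧
      ∀ y, μ.real (Y ⁻¹' {y}) ≠ 0 → condMarginal μ X Y y = P y := by
  obtain ⟨Ω, mΩ, μ, hμ, X, Y, hX, hY, hjoint⟩ := h.exists_joint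
  exact ⟨Ω, mΩ, μ, hμ, X, Y, h.hasMarginal hX hY hjoint, fun y =>
    condMarginal_eq_of_measureReal_inter_eq hX hY fun x => hjoint x y⟩

end Realization

/-! ### Rearranging the components of a mixture -/

theorem exists_perm_mem_iff_lt_card (A : Finset ℕ) :
    ∃ τ : Equiv.Perm ℕ, ∀ i, τ i ∈ A ↔ i < A.card := by
  obtain ⟨τ, hτ⟩ := (Equiv.Perm.isMultiplyPretransitive ℕ A.card).exists_smul_eq
    Fin.valEmbedding (A.equivFin.symm.toEmbedding.trans (Function.Embedding.subtype _))
  have happ (i : Fin A.card) : τ i = A.equivFin.symm i := DFunLike.congr_fun hτ i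
  refine ⟨τ, fun i => ⟨fun hi => ?_, fun hi => ?_⟩⟩
  · have hval := happ (A.equivFin ⟨τ i, hi⟩)
    rw [Equiv.symm_apply_apply] at hval
    rw [← τ.injective hval]
    exact Fin.is_lt _
  · rw [happ ⟨i, hi⟩]
    exact Subtype.property _

theorem exists_blockPerm_antitoneOn (g : ℕ → ℝ) (n : ℕ) :
    ∃ σ : Equiv.Perm (Fin n), AntitoneOn (fun i => g (blockPerm 0 σ i)) (Set.Iio n) := by
  have hsort := Tuple.monotone_sort fun i : Fin n => -g i
  refine ⟨Tuple.sort fun i : Fin n => -g i, fun i hi j hj hij => ?_⟩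
  have happ (k : ℕ) (hk : k < n) :=
    blockPerm_add (a := 0) (Tuple.sort fun i : Fin n => -g i) ⟨k, hk⟩
  simp only [zero_add] at happ
  simp only [happ i hi, happ j hj]
  exact neg_le_neg_iff.1 (hsort (show (⟨i, hi⟩ : Fin n) ≤ ⟨j, hj⟩ from hij))

theorem blockPerm_zero_lt_iff {n : ℕ} (σ : Equiv.Perm (Fin n)) {i : ℕ} :
    blockPerm 0 σ i < n ↔ i < n := by
  rcases lt_or_ge i n with hi | hi
  · have happ := blockPerm_add (a := 0) σ ⟨i, hi⟩
    simp only [zero_add] at happ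
    simp only [happ, hi, Fin.is_lt]
  · rw [blockPerm_of_notMem σ (by simpa using hi)]

namespace Marginal

theorem sum_mass_le_sum_range_perm_blockPerm {P : Marginal} {n : ℕ} {σ : Equiv.Perm (Fin n)}
    (hσ : AntitoneOn (fun i => P.mass (blockPerm 0 σ i)) (Set.Iio n)) {D : Finset ℕ}
    (hD : ∀ i ∈ D, i < n) :
    ∑ x ∈ D, P.mass x ≤ ∑ x ∈ Finset.range D.card, (P.perm (blockPerm 0 σ)).mass x := by
  have hlt : ∀ i ∈ D.map (blockPerm 0 σ).symm.toEmbedding, i < n := fun i hi => by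
    obtain ⟨x, hx, rfl⟩ := Finset.mem_map.1 hi
    rw [← blockPerm_zero_lt_iff σ, Equiv.coe_toEmbedding, Equiv.apply_symm_apply]
    exact hD x hx
  simpa [Finset.sum_map, perm] using sum_le_sum_range_card hσ hlt

theorem sum_range_add_sum_le_topSum (P : Marginal) {d : ℕ} {E : Finset ℕ} (hE : ∀ i ∈ E, d ≤ i) :
    ∑ x ∈ Finset.range d, P.mass x + ∑ x ∈ E, P.mass x ≤ P.topSum (d + E.card) := by
  have hdisj : Disjoint (Finset.range d) E := Finset.disjoint_left.2 fun i hi hi' =>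
    (Finset.mem_range.1 hi).not_ge (hE i hi')
  simpa [Finset.card_union_of_disjoint hdisj, Finset.sum_union hdisj] using
    P.sum_le_topSum (Finset.range d ∪ E)

theorem exists_topSum_add_sub_le_sum (P : Marginal) (n b : ℕ) :
    ∃ E : Finset ℕ, E.card = b ∧ (∀ i ∈ E, n ≤ i) ∧
      P.topSum (n + b) - P.topSum n ≤ ∑ x ∈ E, P.mass x := by
  obtain ⟨C, hC, hCsum⟩ := P.exists_sum_eq_topSum (n + b)
  have hb : b ≤ (C \ Finset.range n).card := by
    have := Finset.le_card_sdiff (Finset.range n) C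
    rw [Finset.card_range] at this
    omega
  obtain ⟨E, hEsub, hE⟩ := Finset.exists_subset_card_eq hb
  have hEC : E ⊆ C := hEsub.trans Finset.sdiff_subset
  have hrest := P.sum_le_topSum (C \ E)
  rw [Finset.card_sdiff_of_subset hEC, hC, hE, Nat.add_sub_cancel] at hrest
  refine ⟨E, hE, fun i hi => ?_, ?_⟩
  · simpa using (Finset.mem_sdiff.1 (hEsub hi)).2
  · rw [← hCsum, ← Finset.sum_sdiff hEC]
    linarith

namespace IsMixture

variable {ι : Type*} {s : Finset ι} {w : ι → ℝ} {P : ι → Marginal} {Q M : Marginal}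

theorem perm (h : IsMixture s w P Q) (τ : Equiv.Perm ℕ) :
    IsMixture s w (fun i => (P i).perm τ) (Q.perm τ) :=
  ⟨h.weight_nonneg, h.sum_weight, fun x => h.mass_eq (τ x)⟩

section Sorted

variable {n : ℕ} {σ : ι → Equiv.Perm (Fin n)}

theorem mass_eq_of_perm_blockPerm (hQ : IsMixture s w P Q)
    (hM : IsMixture s w (fun i => (P i).perm (blockPerm 0 (σ i))) M) {x : ℕ} (hx : n ≤ x) :
    M.mass x = Q.mass x := by
  rw [hQ.mass_eq, hM.mass_eq]
  refine Finset.sum_congr rfl fun i _ => ?_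
  simp only [Marginal.perm, blockPerm_of_notMem (a := 0) (σ i) (x := x) (by simpa using hx)]

variable (hσ : ∀ i, AntitoneOn (fun x => (P i).mass (blockPerm 0 (σ i) x)) (Set.Iio n))
include hσ

theorem sum_add_sum_le_topSum_of_perm_blockPerm (hQ : IsMixture s w P Q)
    (hM : IsMixture s w (fun i => (P i).perm (blockPerm 0 (σ i))) M) {d : ℕ} (hd : d ≤ n)
    {B : ι → Finset ℕ} (hB : ∀ i ∈ s, (B i).card = d) (hBn : ∀ i ∈ s, ∀ x ∈ B i, x < n)
    {E : Finset ℕ} (hE : ∀ x ∈ E, n ≤ x) :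
    ∑ i ∈ s, w i * ∑ x ∈ B i, (P i).mass x + ∑ x ∈ E, Q.mass x ≤ M.topSum (d + E.card) := by
  refine le_trans (add_le_add ?_ ?_) (M.sum_range_add_sum_le_topSum fun x hx => hd.trans (hE x hx))
  · rw [hM.sum_mass]
    refine Finset.sum_le_sum fun i hi => mul_le_mul_of_nonneg_left ?_ (hQ.weight_nonneg i hi)
    exact hB i hi ▸ sum_mass_le_sum_range_perm_blockPerm (hσ i) (hBn i hi)
  · exact Finset.sum_le_sum fun x hx => (hQ.mass_eq_of_perm_blockPerm hM (hE x hx)).ge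

theorem topSum_le_of_perm_blockPerm (hQ : IsMixture s w P Q)
    (hM : IsMixture s w (fun i => (P i).perm (blockPerm 0 (σ i))) M) (k : ℕ) :
    Q.topSum k ≤ M.topSum k := by
  obtain ⟨C, rfl, hCsum⟩ := Q.exists_sum_eq_topSum k
  have hlow : ∀ x ∈ C.filter (· < n), x < n := fun x hx => (Finset.mem_filter.1 hx).2
  have hcard : (C.filter (· < n)).card ≤ n := by
    simpa using Finset.card_le_card fun x hx => Finset.mem_range.2 (hlow x hx)
  rw [← hCsum, ← Finset.sum_filter_add_sum_filter_not C (· < n),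
    ← Finset.card_filter_add_card_filter_not (s := C) (· < n), hQ.sum_mass]
  exact hQ.sum_add_sum_le_topSum_of_perm_blockPerm hσ hM hcard (fun _ _ => rfl)
    (fun _ _ => hlow) fun x hx => not_lt.1 (Finset.mem_filter.1 hx).2

end Sorted

theorem exists_topSum_le_of_forall_lt (hQ : IsMixture s w P Q) {L n : ℕ} (hL : L ≤ n)
    {B : ι → Finset ℕ} (hB : ∀ i ∈ s, (B i).card = L) (hBn : ∀ i ∈ s, ∀ x ∈ B i, x < n) :
    ∃ (R : ι → Marginal) (M : Marginal), (∀ i, (R i).dec = (P i).dec) ∧ IsMixture s w R M ∧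
      (∀ k, Q.topSum k ≤ M.topSum k) ∧
      ∀ b, ∑ i ∈ s, w i * ∑ x ∈ B i, (P i).mass x + (Q.topSum (n + b) - Q.topSum n)
          ≤ M.topSum (L + b) := by
  choose σ hσ using fun i => exists_blockPerm_antitoneOn (P i).mass n
  obtain ⟨M, hM⟩ := exists_isMixture hQ.weight_nonneg hQ.sum_weight
    fun i => (P i).perm (blockPerm 0 (σ i))
  refine ⟨_, M, fun i => dec_perm _ _, hM, hQ.topSum_le_of_perm_blockPerm hσ hM, fun b => ?_⟩
  obtain ⟨E, rfl, hE, hEsum⟩ := Q.exists_topSum_add_sub_le_sum n b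
  exact (add_le_add_right hEsum _).trans
    (hQ.sum_add_sum_le_topSum_of_perm_blockPerm hσ hM hL hB hBn hE)

/-- Sort each `P i` on a common set of `n` symbols that contains `L` largest masses of every
`P i`. -/
theorem exists_topSum_le (hQ : IsMixture s w P Q) {L n : ℕ} (hL : L ≤ n) (hn : s.card * L ≤ n) :
    ∃ (R : ι → Marginal) (M : Marginal), (∀ i, (R i).dec = (P i).dec) ∧ IsMixture s w R M ∧
      (∀ k, Q.topSum k ≤ M.topSum k) ∧
      ∀ b, ∑ i ∈ s, w i * (P i).topSum L + (Q.topSum (n + b) - Q.topSum n)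
          ≤ M.topSum (L + b) := by
  classical
  choose B hB hBsum using fun i => (P i).exists_sum_eq_topSum L
  obtain ⟨A, hBA, rfl⟩ := Infinite.exists_superset_card_eq (s.biUnion B) n
    ((Finset.card_biUnion_le_card_mul _ _ _ fun i _ => (hB i).le).trans hn)
  obtain ⟨τ, hτ⟩ := exists_perm_mem_iff_lt_card A
  have hlt : ∀ i ∈ s, ∀ x ∈ (B i).map τ.symm.toEmbedding, x < A.card := fun i hi x hx => by
    obtain ⟨z, hz, rfl⟩ := Finset.mem_map.1 hx
    rw [← hτ, Equiv.coe_toEmbedding, Equiv.apply_symm_apply]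
    exact hBA (Finset.mem_biUnion.2 ⟨i, hi, hz⟩)
  obtain ⟨R, M, hR, hM, hle, hsum⟩ := (hQ.perm τ).exists_topSum_le_of_forall_lt hL
    (fun i _ => (Finset.card_map _).trans (hB i)) hlt
  simp only [topSum_congr (dec_perm Q τ)] at hle hsum
  refine ⟨R, M, fun i => (hR i).trans (dec_perm _ _), hM, hle, fun b => ?_⟩
  simpa [Marginal.perm, hBsum] using hsum b

end IsMixture

end Marginal

/-! ### Attainment -/

section Counting

variable {κ : Type*} [Fintype κ] {m l : ℕ} {σ : κ → Equiv.Perm (Fin m)}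

theorem card_le_choose_of_injective {α : Type*} {g : Fin m → α} {V W : α}
    (hV : ∀ i : Fin m, i < l → g i = V) (hW : ∀ i : Fin m, l ≤ i → g i = W) (hl : l ≤ m)
    (hinj : Function.Injective fun k i => g (σ k i)) : Fintype.card κ ≤ m.choose l := by
  let S (k : κ) : Finset (Fin m) := {i | (σ k i : ℕ) < l}
  have hcard (k : κ) : (S k).card = l := by
    rw [Finset.card_equiv (t := {i : Fin m | (i : ℕ) < l}) (σ k) (by simp [S]),
      Fin.card_filter_val_lt, min_eq_right hl]
  have hg (k : κ) (i : Fin m) : g (σ k i) = if i ∈ S k then V else W := by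
    split_ifs with hi <;> simp only [S, Finset.mem_filter_univ, not_lt] at hi
    exacts [hV _ hi, hW _ hi]
  have hS : S.Injective := fun j k hjk => hinj (funext fun i => by
    simp only [hg, hjk])
  calc Fintype.card κ = (Finset.univ : Finset κ).card := rfl
    _ ≤ (Finset.powersetCard l (Finset.univ : Finset (Fin m))).card :=
      Finset.card_le_card_of_injOn S (fun k _ => Finset.mem_powersetCard_univ.2 (hcard k))
        hS.injOn
    _ = m.choose l := by rw [Finset.card_powersetCard, Finset.card_fin]

theorem card_le_min_of_affineIndependent {g : Fin m → ℝ} {V W : ℝ}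
    (hV : ∀ i : Fin m, i < l → g i = V) (hW : ∀ i : Fin m, l ≤ i → g i = W)
    (hl : 0 < l) (hlm : l < m) (hind : AffineIndependent ℝ fun k i => g (σ k i)) :
    Fintype.card κ ≤ min (m.choose l) ((m - 1) ^ 2 + 1) := by
  have hchoose := card_le_choose_of_injective hV hW hlm.le hind.injective
  have hdim : Fintype.card κ ≤ m + 1 := by
    refine hind.card_le_finrank_succ.trans (Nat.succ_le_succ ?_)
    simpa using Submodule.finrank_le (vectorSpan ℝ (Set.range fun k i => g (σ k i)))
  refine le_min hchoose ?_
  obtain ⟨d, rfl⟩ : ∃ d, m = d + 2 := ⟨m - 2, by omega⟩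
  rcases d.eq_zero_or_pos with rfl | hd
  · obtain rfl : l = 1 := by omega
    simpa using hchoose
  · rw [Nat.add_sub_assoc (by norm_num)]
    nlinarith

end Counting

namespace Marginal.IsMixture

variable {ι κ : Type*} {Q : Marginal}

theorem push {s : Finset ι} {w : ι → ℝ} {P : ι → Marginal} (h : IsMixture s w P Q) {σ : ℕ → ℕ}
    (hσ : σ.Injective) : IsMixture s w (fun i => (P i).push σ hσ) (Q.push σ hσ) where
  weight_nonneg := h.weight_nonneg
  sum_weight := h.sum_weight
  mass_eq x := by
    by_cases hx : x ∈ Set.range σ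
    · obtain ⟨i, rfl⟩ := hx
      simp only [push_apply, h.mass_eq]
    · simp only [push_apply_of_notMem_range hσ hx, mul_zero, Finset.sum_const_zero]

theorem exists_comp_of_card_le [Fintype ι] [Fintype κ] {w : κ → ℝ} {P : κ → Marginal}
    (h : IsMixture Finset.univ w P Q) (hcard : Fintype.card κ ≤ Fintype.card ι) :
    ∃ (w' : ι → ℝ) (f : ι → κ), IsMixture Finset.univ w' (fun i => P (f i)) Q := by
  obtain ⟨e⟩ := Function.Embedding.nonempty_of_card_le hcard
  have : Nonempty κ := by
    by_contra hκ
    rw [not_nonempty_iff] at hκ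
    simpa using h.sum_weight
  have hzero : ∀ i ∉ Set.range e, Function.extend e w 0 i = 0 := fun i hi =>
    Function.extend_apply' _ _ _ fun hc => hi hc
  have hsum (g : κ → ℝ) :
      ∑ k, w k * g k = ∑ i, Function.extend e w 0 i * g (Function.invFun e i) :=
    Finset.sum_of_injOn e e.injective.injOn (fun _ _ => Finset.mem_coe.2 (Finset.mem_univ _))
      (fun i _ hi => by rw [hzero i (by simpa using hi), zero_mul])
      fun k _ => by rw [e.injective.extend_apply, Function.leftInverse_invFun e.injective]
  refine ⟨Function.extend e w 0, Function.invFun e, fun i _ => ?_, ?_, fun x => ?_⟩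
  · by_cases hi : i ∈ Set.range e
    · obtain ⟨k, rfl⟩ := hi
      rw [e.injective.extend_apply]
      exact h.weight_nonneg k (Finset.mem_univ k)
    · exact (hzero i hi).ge
  · simpa only [mul_one, h.sum_weight] using (hsum fun _ => 1).symm
  · rw [h.mass_eq, hsum fun k => (P k).mass x]

end Marginal.IsMixture

theorem IsFano.exists_isMixture {Q P : Marginal} {a L K : ℕ} {V W c : ℝ}
    (h : IsFano Q a L K V W c P.mass) (haL : a < L) (hLK : L < K) {ι : Type*} [Fintype ι]
    (hcard : min ((K - a).choose (L - a)) ((K - a - 1) ^ 2 + 1) ≤ Fintype.card ι) :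
    ∃ (w : ι → ℝ) (R : ι → Marginal), (∀ i, (R i).dec = P.dec) ∧ IsMixture Finset.univ w R Q := by
  have heq : ∀ i ∉ Finset.Ico a (a + (K - a)), P.mass i = Q.dec.mass i := fun i hi => by
    rw [Finset.mem_Ico] at hi
    rcases lt_or_ge i a with hia | hia
    · exact h.eq_decMass i hia
    · exact h.eq_tail i (by omega)
  have hle : ∀ k ≤ K - a, ∑ i ∈ Finset.range k, Q.dec.mass (a + i)
      ≤ ∑ i ∈ Finset.range k, P.mass (a + i) := fun k _ => by
    have hsum := h.topSum_le_sum (a + k)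
    rwa [topSum, Finset.sum_range_add, Finset.sum_range_add, h.sum_range_eq_topSum le_rfl, topSum,
      add_le_add_iff_left] at hsum
  obtain ⟨κ, _, w, σ, hind, hmix⟩ :=
    exists_isMixture_perm_blockPerm (Q.decMass_antitone.antitoneOn _) heq hle
  have hκ := card_le_min_of_affineIndependent (g := fun i => P.mass (a + i)) (l := L - a)
    (fun i hi => h.eq_V _ (by omega) (by omega)) (fun i hi => h.eq_W _ (by omega) (by omega))
    (by omega) (by omega) hind
  have hpush := hmix.push Q.topSymbol_injective
  rw [push_dec_topSymbol] at hpush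
  obtain ⟨w', f, hmix'⟩ := hpush.exists_comp_of_card_le (hκ.trans hcard)
  exact ⟨w', _, fun i => (dec_push _).trans (dec_perm _ _), hmix'⟩

theorem exists_isMixture_fanoType2 {𝒴 : Type*} [Fintype 𝒴] {Q : Marginal} {L : ℕ} {ε : ℝ}
    (hL : 1 ≤ L) (hN : 1 - Q.topSum (Fintype.card 𝒴 * L) ≤ ε) (hε : ε ≤ Q.listError L)
    (hor : ε = Q.listError L ∨
      min ((fanoK₂ Q L ε (Fintype.card 𝒴) + 1 - fanoJ Q L ε).choose (L + 1 - fanoJ Q L ε) : ℤ)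
        (((fanoK₂ Q L ε (Fintype.card 𝒴) : ℤ) - fanoJ Q L ε) ^ 2 + 1) ≤ Fintype.card 𝒴) :
    ∃ (w : 𝒴 → ℝ) (R : 𝒴 → Marginal),
      (∀ y, (R y).dec = (fanoType2 Q L ε (Fintype.card 𝒴) hL hN hε).dec) ∧
      IsMixture Finset.univ w R Q := by
  by_cases heq : ε = Q.listError L
  · classical
    have hcard := hL.trans (le_mul_of_range hL hN hε)
    obtain ⟨y₀⟩ := Fintype.card_pos_iff.1 (Nat.pos_of_mul_pos_right hcard)
    exact ⟨Pi.single y₀ 1, fun _ => Q, fun _ => (dec_fanoType2_of_eq hL hN hε heq).symm,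
      fun y _ => by rw [Pi.single_apply]; positivity, by simp,
      fun x => by rw [← Finset.sum_mul, Fintype.sum_pi_single', one_mul]⟩
  have hF := isFano_fanoType2 hL hN hε
  obtain ⟨hJ1, hJ2, -⟩ := fanoJ_spec Q L ε hL
  set K := fanoK₂ Q L ε (Fintype.card 𝒴)
  set J := fanoJ Q L ε
  have hne : 1 - ε ≠ Q.topSum L := fun hc => heq (by rw [listError, ← hc, sub_sub_cancel])
  have hJL : J - 1 < L := hF.le_L.lt_of_ne fun hc =>
    hne (hF.sum_eq.symm.trans (hF.sum_range_eq_topSum hc.ge))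
  have hLK : L < K := hF.le_K.lt_of_ne fun hc =>
    hne (hF.sum_eq.symm.trans (hF.sum_range_eq_topSum_of_le hc.ge))
  refine hF.exists_isMixture hJL hLK ?_
  have hmin := hor.resolve_left heq
  rw [← Nat.cast_sub (by omega : J ≤ K)] at hmin
  rw [show K - (J - 1) = K + 1 - J by omega, show L - (J - 1) = L + 1 - J by omega,
    show K + 1 - J - 1 = K - J by omega]
  exact_mod_cast hmin

/-! ### Extremal pairs -/

theorem forall_ae_dec_mass_eq_iff {Ω : Type*} [MeasurableSpace Ω] {μ : Measure Ω}
    {R : Ω → Marginal} {P : Marginal} :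
    (∀ x, ∀ᵐ ω ∂μ, (R ω).dec.mass x = P.dec.mass x) ↔ ∀ᵐ ω ∂μ, (R ω).dec = P.dec := by
  simp only [Marginal.ext_iff, funext_iff, ae_all_iff]

section AlmostSure

variable {Ω 𝒴 : Type*} [MeasurableSpace Ω] [MeasurableSpace 𝒴] {μ : Measure Ω}
  [IsProbabilityMeasure μ] {X : Ω → ℕ} {Y : Ω → 𝒴} {P : Marginal}

theorem condInfo_eq_of_ae_dec_eq {φ : Marginal → ℝ≥0∞} (hsymm : IsSymmetric φ)
    (hdec : ∀ᵐ ω ∂μ, (condMarginal μ X Y (Y ω)).dec = P.dec) : condInfo φ μ X Y = φ P := by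
  calc condInfo φ μ X Y = ∫⁻ _, φ P ∂μ := lintegral_congr_ae (hdec.mono fun _ => hsymm.eq_of_dec_eq)
    _ = φ P := by rw [lintegral_const, measure_univ, mul_one]

theorem condListError_eq_listError_of_ae_dec_eq [Finite 𝒴]
    [MeasurableSingletonClass 𝒴] {L : ℕ} (hL : 1 ≤ L) {Q : Marginal} (h : HasMarginal Q μ X Y)
    (hdec : ∀ᵐ ω ∂μ, (condMarginal μ X Y (Y ω)).dec = P.dec) :
    condListError L μ X Y = P.listError L := by
  cases nonempty_fintype 𝒴
  have hy := (ae_comp_iff_forall_measureReal_ne_zero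
    (p := fun y => (condMarginal μ X Y y).dec = P.dec)).1 hdec
  rw [condListError_eq_one_sub_sum hL h.measurable_fst h.measurable_snd, listError, sub_right_inj]
  calc ∑ y, μ.real (Y ⁻¹' {y}) * (condMarginal μ X Y y).topSum L
      = ∑ y, μ.real (Y ⁻¹' {y}) * P.topSum L :=
        Finset.sum_congr rfl fun y _ => by
          by_cases h0 : μ.real (Y ⁻¹' {y}) = 0
          · rw [h0, zero_mul, zero_mul]
          · rw [topSum_congr (hy y h0)]
    _ = P.topSum L := by rw [← Finset.sum_mul, h.isMixture.sum_weight, one_mul]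

end AlmostSure

section Main

variable {φ : Marginal → ℝ≥0∞} {Ω : Type u} {𝒴 : Type v} [MeasurableSpace Ω] [Fintype 𝒴]
  [MeasurableSpace 𝒴] [MeasurableSingletonClass 𝒴] {Q : Marginal} {L : ℕ} {ε : ℝ} {μ : Measure Ω}
  [IsProbabilityMeasure μ] {X : Ω → ℕ} {Y : Ω → 𝒴}

variable (hsymm : IsSymmetric φ) (hL : 1 ≤ L) (hN : 1 - Q.topSum (Fintype.card 𝒴 * L) ≤ ε)
  (hε : ε ≤ Q.listError L)

include hsymm in
theorem exists_isMixture_topSum_fanoType2_le (h : HasMarginal Q μ X Y)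
    (herr : condListError L μ X Y ≤ ε) :
    ∃ (R : 𝒴 → Marginal) (M : Marginal), (∀ y, (R y).dec = (condMarginal μ X Y y).dec) ∧
      IsMixture Finset.univ (fun y => μ.real (Y ⁻¹' {y})) R M ∧
      condInfo φ μ X Y = ∑ y, ENNReal.ofReal (μ.real (Y ⁻¹' {y})) * φ (R y) ∧
      ∀ k, (fanoType2 Q L ε (Fintype.card 𝒴) hL hN hε).topSum k ≤ M.topSum k := by
  obtain ⟨R, M, hR, hM, hQM, hb⟩ :=
    h.isMixture.exists_topSum_le (le_mul_of_range hL hN hε) le_rfl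
  refine ⟨R, M, hR, hM, ?_, topSum_fanoType2_le hL hN hε hQM fun b => ?_⟩
  · simp only [condInfo_eq_sum φ h.measurable_snd, fun y => hsymm.eq_of_dec_eq (hR y)]
  · rw [condListError_eq_one_sub_sum hL h.measurable_fst h.measurable_snd] at herr
    exact (add_le_add_left (by linarith) _).trans (hb b)

include hsymm in
theorem condListError_le_and_condInfo_eq_of_ae_dec_eq (h : HasMarginal Q μ X Y)
    (hdec : ∀ᵐ ω ∂μ, (condMarginal μ X Y (Y ω)).dec
      = (fanoType2 Q L ε (Fintype.card 𝒴) hL hN hε).dec) :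
    condListError L μ X Y ≤ ε ∧
      condInfo φ μ X Y = φ (fanoType2 Q L ε (Fintype.card 𝒴) hL hN hε) := by
  refine ⟨?_, condInfo_eq_of_ae_dec_eq hsymm hdec⟩
  rw [condListError_eq_listError_of_ae_dec_eq hL h hdec, listError]
  linarith [one_sub_le_topSum_fanoType2 hL hN hε]

variable (hconc : IsConcave φ) (hlsc : IsLowerSemicont φ)

include hsymm hconc hlsc

theorem condInfo_le_fanoType2 (h : HasMarginal Q μ X Y) (herr : condListError L μ X Y ≤ ε) :
    condInfo φ μ X Y ≤ φ (fanoType2 Q L ε (Fintype.card 𝒴) hL hN hε) := by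
  obtain ⟨R, M, -, hM, hinfo, hle⟩ := exists_isMixture_topSum_fanoType2_le hsymm hL hN hε h herr
  calc condInfo φ μ X Y = ∑ y, ENNReal.ofReal (μ.real (Y ⁻¹' {y})) * φ (R y) := hinfo
    _ ≤ φ M := hconc.sum_le hM
    _ ≤ _ := le_of_topSum_le hsymm hconc hlsc hle

theorem ae_dec_eq_of_condInfo_eq (hstrict : IsStrictConcave φ)
    (hfin : φ (fanoType2 Q L ε (Fintype.card 𝒴) hL hN hε) ≠ ∞)
    (h : HasMarginal Q μ X Y) (herr : condListError L μ X Y ≤ ε)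
    (hinfo : condInfo φ μ X Y = φ (fanoType2 Q L ε (Fintype.card 𝒴) hL hN hε)) :
    ∀ᵐ ω ∂μ, (condMarginal μ X Y (Y ω)).dec
      = (fanoType2 Q L ε (Fintype.card 𝒴) hL hN hε).dec := by
  obtain ⟨R, M, hR, hM, hsum, hle⟩ := exists_isMixture_topSum_fanoType2_le hsymm hL hN hε h herr
  have hMP := le_of_topSum_le hsymm hconc hlsc hle
  rw [← hinfo, hsum] at hMP
  have hMφ : φ M = φ (fanoType2 Q L ε (Fintype.card 𝒴) hL hN hε) := by
    rw [← hinfo, hsum]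
    exact hMP.antisymm (hconc.sum_le hM)
  refine (ae_comp_iff_forall_measureReal_ne_zero (p := fun y => (condMarginal μ X Y y).dec
    = (fanoType2 Q L ε (Fintype.card 𝒴) hL hN hε).dec)).2 fun y hy => ?_
  calc (condMarginal μ X Y y).dec = (R y).dec := (hR y).symm
    _ = M.dec := by
      rw [hconc.eq_of_le_sum hstrict hM (hMφ ▸ hfin) hMP (Finset.mem_univ y) hy]
    _ = _ := dec_eq_of_topSum_le hsymm hconc hlsc hstrict hle hfin hMφ

theorem condListError_le_and_condInfo_eq_iff (hstrict : IsStrictConcave φ)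
    (hfin : φ (fanoType2 Q L ε (Fintype.card 𝒴) hL hN hε) ≠ ∞) (h : HasMarginal Q μ X Y) :
    (condListError L μ X Y ≤ ε ∧
      condInfo φ μ X Y = φ (fanoType2 Q L ε (Fintype.card 𝒴) hL hN hε)) ↔
    ∀ᵐ ω ∂μ, (condMarginal μ X Y (Y ω)).dec
      = (fanoType2 Q L ε (Fintype.card 𝒴) hL hN hε).dec :=
  ⟨fun ⟨herr, hinfo⟩ =>
    ae_dec_eq_of_condInfo_eq hsymm hL hN hε hconc hlsc hstrict hfin h herr hinfo,
    condListError_le_and_condInfo_eq_of_ae_dec_eq hsymm hL hN hε h⟩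

theorem supCondInfo_le_fanoType2 :
    supCondInfo.{u, v} φ Q L ε 𝒴 ≤ φ (fanoType2 Q L ε (Fintype.card 𝒴) hL hN hε) := by
  refine sSup_le ?_
  rintro _ ⟨Ω, _, μ, _, X, Y, h, herr, rfl⟩
  exact condInfo_le_fanoType2 hsymm hL hN hε hconc hlsc h herr

theorem supCondInfo_eq_fanoType2_of_ae_dec_eq (h : HasMarginal Q μ X Y)
    (hdec : ∀ᵐ ω ∂μ, (condMarginal μ X Y (Y ω)).dec
      = (fanoType2 Q L ε (Fintype.card 𝒴) hL hN hε).dec) :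
    supCondInfo.{u, v} φ Q L ε 𝒴 = φ (fanoType2 Q L ε (Fintype.card 𝒴) hL hN hε) := by
  obtain ⟨herr, hinfo⟩ := condListError_le_and_condInfo_eq_of_ae_dec_eq hsymm hL hN hε h hdec
  exact (supCondInfo_le_fanoType2 hsymm hL hN hε hconc hlsc).antisymm
    (le_sSup ⟨Ω, _, μ, inferInstance, X, Y, h, herr, hinfo.symm⟩)

theorem supCondInfo_eq_fanoType2_of_isMixture {w : 𝒴 → ℝ} {R : 𝒴 → Marginal}
    (hmix : IsMixture Finset.univ w R Q)
    (hR : ∀ y, (R y).dec = (fanoType2 Q L ε (Fintype.card 𝒴) hL hN hε).dec) :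
    supCondInfo.{u, v} φ Q L ε 𝒴 = φ (fanoType2 Q L ε (Fintype.card 𝒴) hL hN hε) := by
  obtain ⟨Ω, _, μ, _, X, Y, h, hcond⟩ := hmix.exists_hasMarginal.{u, v}
  refine supCondInfo_eq_fanoType2_of_ae_dec_eq hsymm hL hN hε hconc hlsc h ?_
  exact (ae_comp_iff_forall_measureReal_ne_zero (p := fun y => (condMarginal μ X Y y).dec
    = (fanoType2 Q L ε (Fintype.card 𝒴) hL hN hε).dec)).2 fun y hy => by rw [hcond y hy, hR y]

end Main

theorem fanoType2_le_fanoType1 {φ : Marginal → ℝ≥0∞} (hsymm : IsSymmetric φ)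
    (hconc : IsConcave φ) (hlsc : IsLowerSemicont φ) {Q : Marginal} {L N : ℕ} {ε : ℝ} (hL : 1 ≤ L)
    (hN : 1 - Q.topSum (N * L) ≤ ε) (hε : ε ≤ Q.listError L) :
    φ (fanoType2 Q L ε N hL hN hε)
      ≤ φ (fanoType1 Q L ε hL (eps_nonneg_of_range Q L ε hN) hε) :=
  le_of_topSum_le hsymm hconc hlsc (topSum_fanoType1_le hL _ hε (topSum_le_fanoType2 hL hN hε)
    (one_sub_le_topSum_fanoType2 hL hN hε))

theorem theorem2 (φ : Marginal → ℝ≥0∞) (hsymm : IsSymmetric φ) (hconc : IsConcave φ)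
    (hlsc : IsLowerSemicont φ)
    (𝒴 : Type v) [Fintype 𝒴] [MeasurableSpace 𝒴] [MeasurableSingletonClass 𝒴]
    (Q : Marginal) (L : ℕ) (hL : 1 ≤ L) (ε : ℝ)
    (hε₁ : 1 - Q.topSum (Fintype.card 𝒴 * L) ≤ ε) (hε₂ : ε ≤ Q.listError L)
    (P₁ P₂ : Marginal) (J K₂ : ℕ)
    (hP₁ : P₁ = fanoType1 Q L ε hL (eps_nonneg_of_range Q L ε hε₁) hε₂)
    (hP₂ : P₂ = fanoType2 Q L ε (Fintype.card 𝒴) hL hε₁ hε₂)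
    (hJ : J = fanoJ Q L ε) (hK₂ : K₂ = fanoK₂ Q L ε (Fintype.card 𝒴)) :
    -- the bound, and its comparison with the bound for arbitrary side information
    supCondInfo.{u, v} φ Q L ε 𝒴 ≤ φ P₂ ∧
    φ P₂ ≤ φ P₁ ∧
    -- sufficient conditions for equality
    ((ε = Q.listError L ∨
        min ((K₂ + 1 - J).choose (L + 1 - J) : ℤ) (((K₂ : ℤ) - J) ^ 2 + 1) ≤ Fintype.card 𝒴) →
      supCondInfo.{u, v} φ Q L ε 𝒴 = φ P₂) ∧
    -- a sufficient condition on the pair `(X, Y)` for attaining the supremum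
    (∀ (Ω : Type u) [MeasurableSpace Ω] (μ : Measure Ω) [IsProbabilityMeasure μ]
        (X : Ω → ℕ) (Y : Ω → 𝒴), HasMarginal Q μ X Y →
      (∀ x, ∀ᵐ ω ∂μ, (condMarginal μ X Y (Y ω)).dec.mass x = P₂.dec.mass x) →
      condListError L μ X Y ≤ ε ∧
        condInfo φ μ X Y = supCondInfo.{u, v} φ Q L ε 𝒴 ∧
        supCondInfo.{u, v} φ Q L ε 𝒴 = φ P₂) ∧
    -- its necessity, when equality holds in the bound, for strictly concave `φ`
    (IsStrictConcave φ → φ P₂ ≠ ∞ → supCondInfo.{u, v} φ Q L ε 𝒴 = φ P₂ →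
      ∀ (Ω : Type u) [MeasurableSpace Ω] (μ : Measure Ω) [IsProbabilityMeasure μ]
        (X : Ω → ℕ) (Y : Ω → 𝒴), HasMarginal Q μ X Y →
      ((condListError L μ X Y ≤ ε ∧
          condInfo φ μ X Y = supCondInfo.{u, v} φ Q L ε 𝒴) ↔
        ∀ x, ∀ᵐ ω ∂μ, (condMarginal μ X Y (Y ω)).dec.mass x = P₂.dec.mass x)) := by
  subst hP₁ hP₂ hJ hK₂
  refine ⟨supCondInfo_le_fanoType2 hsymm hL hε₁ hε₂ hconc hlsc,
    fanoType2_le_fanoType1 hsymm hconc hlsc hL hε₁ hε₂, fun hor => ?_,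
    fun Ω _ μ _ X Y h hae => ?_, fun hstrict hfin hsup Ω _ μ _ X Y h => ?_⟩
  · obtain ⟨w, R, hR, hmix⟩ := exists_isMixture_fanoType2 hL hε₁ hε₂ hor
    exact supCondInfo_eq_fanoType2_of_isMixture hsymm hL hε₁ hε₂ hconc hlsc hmix hR
  · have hdec := forall_ae_dec_mass_eq_iff.1 hae
    have hsup := supCondInfo_eq_fanoType2_of_ae_dec_eq hsymm hL hε₁ hε₂ hconc hlsc h hdec
    rw [hsup]
    obtain ⟨herr, hinfo⟩ :=
      condListError_le_and_condInfo_eq_of_ae_dec_eq hsymm hL hε₁ hε₂ h hdec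
    exact ⟨herr, hinfo, rfl⟩
  · rw [hsup, forall_ae_dec_mass_eq_iff]
    exact condListError_le_and_condInfo_eq_iff hsymm hL hε₁ hε₂ hconc hlsc hstrict hfin h
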